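/- **Setting.** Let $X$ be a proper geodesic Gromov hyperbolic metric space (geodesic triangles are uniformly slim), $o\in X$ a base point, and let $\Gamma\subset\mathrm{Isom}(X)$ be a discrete group acting cocompactly on $X$. Write $M=\partial_\infty X$ for the Gromov boundary and $M^{(2)}=\{(x,y)\in M^2: x\neq y\}$. For a sequence $(\gamma_n)$ in $\Gamma$ and $x,y\in M$ write $\gamma_n|_{M\setminus\{y\}}\to x$ for locally uniform convergence on $M\setminus\{y\}$ to the constant $x$. The limit set $\Lambda(\Gamma)$ is the set of $x\in M$ such that $\gamma_n|_{M\setminus\{y\}}\to x$ for some $y\in M$ and some sequence $(\gamma_n)$ in $\Gamma$; assume that it has at least three points. Fix a metric $d$ on $\Gamma\sqcup M$ that is *compatible*, i.e. $\Gamma\sqcup M$ is compact, the inclusions of $\Gamma$ (with the discrete topology) and of $M$ are topological embeddings, and $\Gamma$ (acting on itself by left multiplication) acts on $\Gamma\sqcup M$ as a convergence group: it acts by homeomorphisms, and every sequence of distinct elements has a subsequence converging locally uniformly on the complement of one point to a constant. **Definitions.** * A function $\sigma:\Gamma\times M\to\mathbb R$ is a *$\kappa$-coarse-cocycle* if $\limsup_{x\to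 x_0}|\sigma(\gamma,x_0)-\sigma(\gamma,x)|\le\kappa$ and $|\sigma(\gamma_1\gamma_2,x)-(\sigma(\gamma_1,\gamma_2x)+\sigma(\gamma_2,x))|\le\kappa$ for all $\gamma,\gamma_1,\gamma_2\in\Gamma$ and $x_0,x\in M$. It is a *coarse-cocycle* if this holds for some $\kappa$. * An element $\gamma\in\Gamma$ is *loxodromic* if it fixes two distinct points $\gamma^+,\gamma^-\in\Lambda(\Gamma)$ such that $\gamma^{\pm n}|_{M\setminus\{\gamma^{\mp}\}}\to\gamma^{\pm}$. * A coarse-cocycle $\sigma$ is *proper* if $\sigma(\gamma_n,\gamma_n^+)\to+\infty$ for every sequence $(\gamma_n)$ of distinct loxodromic elements with $\liminf_n d(\gamma_n^-,\gamma_n^+)>0$. * It is *expanding* if it is proper and there are numbers $\|\gamma\|_\sigma\in\mathbb R$ $(\gamma\in\Gamma)$ such that for every $\epsilon>0$ there is $C>0$ with $\|\gamma\|_\sigma-C\le\sigma(\gamma,x)\le\|\gamma\|_\sigma+C$ whenever $x\in M$, $\gamma\in\Gamma$ and $d(x,\gamma^{-1})>\epsilon$. * A *$\kappa$-coarse Gromov–Patterson–Sullivan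 (GPS) system* is a triple $(\sigma,\bar\sigma,G)$ of two proper $\kappa$-coarse-cocycles $\sigma,\bar\sigma$ and a locally bounded function $G:M^{(2)}\to\mathbb R$ with $|(\bar\sigma(\gamma,x)+\sigma(\gamma,y))-(G(\gamma x,\gamma y)-G(x,y))|\le\kappa$ for all $\gamma\in\Gamma$ and distinct $x,y\in M$. * A function $\psi:X\times X\to\mathbb R$ is a *coarsely additive potential* if (1) $\lim_{r\to\infty}\inf_{d_X(p,q)\ge r}\psi(p,q)=+\infty$; (2) $\sup_{d_X(p,q)\le r}|\psi(p,q)|<\infty$ for every $r>0$; (3) for every $r>0$ there is $\kappa(r)>0$ such that $|\psi(p,q)-(\psi(p,u)+\psi(u,q))|\le\kappa(r)$ whenever $u$ lies in the $r$-neighbourhood of a geodesic joining $p$ to $q$. It is *$\Gamma$-invariant* if $\psi(\gamma p,\gamma q)=\psi(p,q)$ for all $\gamma\in\Gamma$ and $p,q\in X$. Put $$\sigma_\psi(\gamma,x)=\limsup_{p\to x}\big(\psi(\gamma^{-1}o,p)-\psi(o,p)\big)\in[-\infty,+\infty],$$ where $p\in X$ converges to $x\in M$ in the usual topology of $X\sqcup\partial_\infty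 X$. **Theorem.** Let $\sigma:\Gamma\times\partial_\infty X\to\mathbb R$ be an expanding coarse-cocycle. Then there is a $\Gamma$-invariant coarsely additive potential $\psi:X\times X\to\mathbb R$ such that $\sigma_\psi$ is finite everywhere and $$\sup_{\gamma\in\Gamma,\ x\in\partial_\infty X}|\sigma_\psi(\gamma,x)-\sigma(\gamma,x)|<+\infty .$$ In particular, $\sigma$ is contained in a coarse GPS system: there are $\kappa$, $\bar\sigma$ and $G$ such that $(\sigma,\bar\sigma,G)$ is a $\kappa$-coarse GPS system. -/

import Mathlib

open Filter Topology Set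
open scoped NNReal

noncomputable section

/-! ## Convergence actions and their compactifications -/

section Convergence

variable {Γ : Type*} {M : Type*} [Group Γ] [TopologicalSpace M] [MulAction Γ M]

/-- The maps `g n`, restricted to `M ∖ {y}`, converge locally uniformly to the constant `x`:
every `z ≠ y` and every neighbourhood `U` of `x` admit a neighbourhood `V` of `z` with
`g n • V ⊆ U` for all large `n`. -/
def ConvergesOff (g : ℕ → Γ) (y x : M) : Prop :=
  ∀ z : M, z ≠ y → Tendsto (fun p : ℕ × M => g p.1 • p.2) (atTop ×ˢ 𝓝 z) (𝓝 x)

variable (Γ M) in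
/-- `Γ` acts on the compact metrizable space `M` by homeomorphisms as a (discrete) convergence
group. The action need not be effective. -/
structure IsConvergenceAction : Prop where
  compact : CompactSpace M
  metrizable : TopologicalSpace.MetrizableSpace M
  continuous_smul : ∀ γ : Γ, Continuous fun x : M => γ • x
  exists_subseq : ∀ g : ℕ → Γ, Function.Injective g →
    ∃ x y : M, ∃ φ : ℕ → ℕ, StrictMono φ ∧ ConvergesOff (g ∘ φ) y x

variable (Γ M) in
/-- The limit set of the action of `Γ` on `M`. -/
def limitSet : Set M :=
  {x | ∃ y : M, ∃ g : ℕ → Γ, ConvergesOff g y x}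

variable (Γ M) in
/-- The action is non-elementary: the limit set has at least three points. -/
def IsNonelementary : Prop := 3 ≤ (limitSet Γ M).encard

/-- `γ` is loxodromic with attracting fixed point `a` and repelling fixed point `b`. -/
structure IsLoxodromic (γ : Γ) (a b : M) : Prop where
  ne : a ≠ b
  attracting_mem : a ∈ limitSet Γ M
  repelling_mem : b ∈ limitSet Γ M
  attracting_fixed : γ • a = a
  repelling_fixed : γ • b = b
  tendsto_attracting : ConvergesOff (fun n : ℕ => γ ^ n) b a
  tendsto_repelling : ConvergesOff (fun n : ℕ => γ⁻¹ ^ n) a b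

end Convergence

/-- The disjoint union `Γ ⊔ M`, as a bare set (it carries no topology by default). -/
def GroupUnion (Γ : Type*) (M : Type*) := Γ ⊕ M

/-- `Γ` acts on `Γ ⊔ M` by left multiplication on `Γ` and by the given action on `M`. -/
instance GroupUnion.instMulAction {Γ M : Type*} [Group Γ] [MulAction Γ M] :
    MulAction Γ (GroupUnion Γ M) :=
  inferInstanceAs (MulAction Γ (Γ ⊕ M))

/-- The inclusion of `Γ` in `Γ ⊔ M`. -/
def GroupUnion.ofGroup {Γ M : Type*} (γ : Γ) : GroupUnion Γ M := Sum.inl γ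

/-- The inclusion of `M` in `Γ ⊔ M`. -/
def GroupUnion.ofPoint {Γ M : Type*} (x : M) : GroupUnion Γ M := Sum.inr x

/-- The given metric on `Γ ⊔ M` is compatible: it induces a compactifying topology, i.e. `Γ ⊔ M`
is compact, the inclusions of `Γ` (with the discrete topology) and of `M` are embeddings, and `Γ`
acts on `Γ ⊔ M` as a convergence group. -/
structure IsCompatibleMetric (Γ M : Type*) [Group Γ] [TopologicalSpace M] [MulAction Γ M]
    [MetricSpace (GroupUnion Γ M)] : Prop where
  group_embedding : @IsEmbedding Γ (GroupUnion Γ M) ⊥ _ GroupUnion.ofGroup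
  point_embedding : IsEmbedding (GroupUnion.ofPoint : M → GroupUnion Γ M)
  convergence : IsConvergenceAction Γ (GroupUnion Γ M)

/-! ## Coarse-cocycles and Gromov-Patterson-Sullivan systems -/

section Cocycle

variable {Γ : Type*} {M : Type*} [Group Γ] [TopologicalSpace M] [MulAction Γ M]

/-- `σ` is a `κ`-coarse-cocycle. -/
structure IsCoarseCocycle (κ : ℝ) (σ : Γ → M → ℝ) : Prop where
  coarselyContinuous : ∀ (γ : Γ) (x₀ : M),
    limsup (fun x : M => ((|σ γ x₀ - σ γ x| : ℝ) : EReal)) (𝓝 x₀) ≤ (κ : EReal)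
  cocycle : ∀ (γ₁ γ₂ : Γ) (x : M), |σ (γ₁ * γ₂) x - (σ γ₁ (γ₂ • x) + σ γ₂ x)| ≤ κ

variable [MetricSpace (GroupUnion Γ M)]

/-- `σ` is proper: `σ (g n) (g n)⁺ → +∞` for every sequence of distinct loxodromic elements `g n`
whose repelling and attracting points `b n`, `a n` satisfy `liminf d (b n) (a n) > 0`. -/
def IsProperCocycle (σ : Γ → M → ℝ) : Prop :=
  ∀ (g : ℕ → Γ) (a b : ℕ → M), Function.Injective g →
    (∀ n, IsLoxodromic (g n) (a n) (b n)) →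
    (∃ ε > 0, ∀ᶠ n in atTop,
      ε ≤ dist (GroupUnion.ofPoint (b n) : GroupUnion Γ M) (GroupUnion.ofPoint (a n))) →
    Tendsto (fun n => σ (g n) (a n)) atTop atTop

/-- `σ` is an expanding coarse-cocycle; the number `N γ` is the magnitude of `γ`. -/
structure IsExpandingCoarseCocycle (σ : Γ → M → ℝ) : Prop where
  coarseCocycle : ∃ κ : ℝ, IsCoarseCocycle κ σ
  proper : IsProperCocycle σ
  expanding : ∃ N : Γ → ℝ, ∀ ε > 0, ∃ C > 0, ∀ (γ : Γ) (x : M),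
    ε < dist (GroupUnion.ofPoint x : GroupUnion Γ M) (GroupUnion.ofGroup γ⁻¹) →
      N γ - C ≤ σ γ x ∧ σ γ x ≤ N γ + C

/-- `(σ, σ', G)` is a `κ`-coarse Gromov-Patterson-Sullivan system, where `G` is defined on the
space of ordered pairs of distinct points of `M`. -/
structure IsCoarseGPSSystem (κ : ℝ) (σ σ' : Γ → M → ℝ)
    (G : {z : M × M // z.1 ≠ z.2} → ℝ) : Prop where
  coarseCocycle : IsCoarseCocycle κ σ
  coarseCocycle' : IsCoarseCocycle κ σ'
  proper : IsProperCocycle σ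
  proper' : IsProperCocycle σ'
  locallyBounded : ∀ z, ∃ U ∈ 𝓝 z, ∃ B : ℝ, ∀ w ∈ U, |G w| ≤ B
  gromov : ∀ (γ : Γ) (x y : M) (h : x ≠ y),
    |(σ' γ x + σ γ y) -
      (G ⟨(γ • x, γ • y), fun e => h (MulAction.injective γ e)⟩ - G ⟨(x, y), h⟩)| ≤ κ

end Cocycle

/-! ## Geodesic Gromov hyperbolic spaces -/

section Hyperbolic

variable {X : Type*} [MetricSpace X]

/-- `s` is (the image of) a geodesic segment joining `p` to `q`. -/
def IsGeodesicSegment (s : Set X) (p q : X) : Prop :=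
  ∃ c : ℝ → X, (∀ t ∈ Icc 0 (dist p q), ∀ t' ∈ Icc 0 (dist p q), dist (c t) (c t') = |t - t'|) ∧
    c 0 = p ∧ c (dist p q) = q ∧ s = c '' Icc 0 (dist p q)

variable (X) in
/-- Any two points are joined by a geodesic segment. -/
def IsGeodesicSpace : Prop := ∀ p q : X, ∃ s : Set X, IsGeodesicSegment s p q

variable (X) in
/-- Gromov hyperbolicity: for some `δ`, every geodesic triangle is `δ`-slim. -/
def IsGromovHyperbolic : Prop :=
  ∃ δ : ℝ, ∀ (p q r : X) (s₁ s₂ s₃ : Set X),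
    IsGeodesicSegment s₁ p q → IsGeodesicSegment s₂ q r → IsGeodesicSegment s₃ r p →
      ∀ u ∈ s₁, ∃ v ∈ s₂ ∪ s₃, dist u v ≤ δ

variable (X) in
/-- Geodesic rays `[0, ∞) → X`. -/
def GeodesicRay := {c : ℝ≥0 → X // Isometry c}

variable (X) in
/-- Two geodesic rays are asymptotic if they stay at bounded distance. -/
instance GeodesicRay.setoid : Setoid (GeodesicRay X) where
  r c c' := ∃ C : ℝ, ∀ t, dist (c.1 t) (c'.1 t) ≤ C
  iseqv :=
    { refl := fun c => ⟨0, fun t => by simp⟩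
      symm := fun ⟨C, h⟩ => ⟨C, fun t => by rw [dist_comm]; exact h t⟩
      trans := fun ⟨C, h⟩ ⟨C', h'⟩ =>
        ⟨C + C', fun t => (dist_triangle _ _ _).trans (add_le_add (h t) (h' t))⟩ }

variable (X) in
/-- The Gromov boundary: asymptote classes of geodesic rays. -/
def GromovBoundary := Quotient (GeodesicRay.setoid X)

/-- The Gromov product of `p` and `q` based at `o`. -/
def gromovProduct (o p q : X) : ℝ := (dist o p + dist o q - dist p q) / 2

/-- The Gromov product of a boundary point `ξ` and a point `p` of `X`, based at `o`. -/
def gromovProductPoint (o : X) (ξ : GromovBoundary X) (p : X) : EReal :=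
  ⨆ (c : GeodesicRay X) (_ : Quotient.mk _ c = ξ),
    liminf (fun t : ℝ≥0 => (gromovProduct o (c.1 t) p : EReal)) atTop

/-- The Gromov product of two boundary points `ξ`, `η`, based at `o`. -/
def gromovProductBoundary (o : X) (ξ η : GromovBoundary X) : EReal :=
  ⨆ (c : GeodesicRay X) (_ : Quotient.mk _ c = ξ) (c' : GeodesicRay X)
    (_ : Quotient.mk _ c' = η),
    liminf (fun t : ℝ≥0 × ℝ≥0 => (gromovProduct o (c.1 t.1) (c'.1 t.2) : EReal))
      (atTop ×ˢ atTop)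

/-- The usual topology of the Gromov boundary: `η` is close to `ξ` when their Gromov product is
large. A change of base point changes Gromov products by a bounded amount, so that "for every `o`"
could equally be "for some `o`". -/
instance GromovBoundary.instTopologicalSpace : TopologicalSpace (GromovBoundary X) where
  IsOpen U := ∀ ξ ∈ U, ∀ o : X, ∃ R : ℝ, ∀ η, (R : EReal) < gromovProductBoundary o ξ η → η ∈ U
  isOpen_univ := fun _ _ _ => ⟨0, fun _ _ => mem_univ _⟩
  isOpen_inter := fun U V hU hV ξ hξ o => by
    obtain ⟨R, hR⟩ := hU ξ hξ.1 o
    obtain ⟨R', hR'⟩ := hV ξ hξ.2 o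
    refine ⟨max R R', fun η h => ⟨hR η (lt_of_le_of_lt ?_ h), hR' η (lt_of_le_of_lt ?_ h)⟩⟩
    · exact_mod_cast le_max_left R R'
    · exact_mod_cast le_max_right R R'
  isOpen_sUnion := fun S hS ξ ⟨U, hU, hξ⟩ o => by
    obtain ⟨R, hR⟩ := hS U hU ξ hξ o
    exact ⟨R, fun η h => ⟨U, hU, hR η h⟩⟩

/-- The filter `p → ξ` of points `p` of `X` converging to the boundary point `ξ` in the usual
topology of the disjoint union of `X` and its Gromov boundary: `(ξ | p)_o → ∞`. -/
def GromovBoundary.nhdsIn (ξ : GromovBoundary X) : Filter X :=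
  ⨅ (o : X) (R : ℝ), 𝓟 {p : X | (R : EReal) < gromovProductPoint o ξ p}

/-- Isometries act on geodesic rays. -/
def GeodesicRay.map (γ : X ≃ᵢ X) (c : GeodesicRay X) : GeodesicRay X :=
  ⟨fun t => γ (c.1 t), γ.isometry.comp c.2⟩

/-- The action of the isometry group on the Gromov boundary. -/
instance GromovBoundary.instMulAction : MulAction (X ≃ᵢ X) (GromovBoundary X) where
  smul γ := Quotient.map (GeodesicRay.map γ) fun _ _ ⟨C, h⟩ =>
    ⟨C, fun t => (γ.dist_eq _ _).le.trans (h t)⟩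
  one_smul := by rintro ⟨c⟩; rfl
  mul_smul := by rintro γ γ' ⟨c⟩; rfl

/-- The group `Γ` of isometries is discrete for the compact-open topology. -/
def IsDiscreteGroup (Γ : Subgroup (X ≃ᵢ X)) : Prop :=
  DiscreteTopology (range fun γ : Γ => (⟨γ.1, γ.1.continuous⟩ : C(X, X)))

/-- `Γ` acts cocompactly: the translates of some compact set cover `X`. -/
def IsCocompact (Γ : Subgroup (X ≃ᵢ X)) : Prop :=
  ∃ K : Set X, IsCompact K ∧ ∀ p : X, ∃ γ ∈ Γ, ∃ k ∈ K, γ k = p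

/-! ## Coarsely additive potentials -/

/-- `ψ` is a coarsely additive potential. -/
structure IsCoarselyAdditivePotential (ψ : X → X → ℝ) : Prop where
  proper : ∀ B : ℝ, ∃ r : ℝ, ∀ p q : X, r ≤ dist p q → B ≤ ψ p q
  bounded : ∀ r > 0, ∃ B : ℝ, ∀ p q : X, dist p q ≤ r → |ψ p q| ≤ B
  additive : ∀ r > 0, ∃ κ > 0, ∀ (p q u : X) (s : Set X), IsGeodesicSegment s p q →
    (∃ v ∈ s, dist u v < r) → |ψ p q - (ψ p u + ψ u q)| ≤ κ

/-- `ψ` is invariant under the diagonal action of `Γ`. -/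
def IsInvariantPotential (Γ : Subgroup (X ≃ᵢ X)) (ψ : X → X → ℝ) : Prop :=
  ∀ γ ∈ Γ, ∀ p q : X, ψ (γ p) (γ q) = ψ p q

/-- `σ_ψ (γ, ξ) = limsup_{p → ξ} (ψ (γ⁻¹ o, p) - ψ (o, p))`, an extended real number. -/
def potentialCocycle {Γ : Subgroup (X ≃ᵢ X)} (o : X) (ψ : X → X → ℝ) (γ : Γ)
    (ξ : GromovBoundary X) : EReal :=
  limsup (fun p : X => ((ψ ((γ : X ≃ᵢ X).symm o) p - ψ o p : ℝ) : EReal)) ξ.nhdsIn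

end Hyperbolic

end

/-! ## Dynamics on the compactification `Γ ⊔ M` -/

section Dynamics

/-! Expansion supplies numbers `N γ` with `σ γ x` within a constant of `N γ` as long as `x` stays
away from `γ⁻¹`. The potential is modelled on `ψ (α o) (β o) = N (α⁻¹ β)` and extended coarsely from
the orbit of `o` to `X` by cocompactness.

Additivity comes from evaluating the cocycle relation for `α⁻¹ β` at a boundary point `x`: if `x` is
far from `β⁻¹` and `β⁻¹ α`, and `β x` is far from `α`, it reads `N (α⁻¹ β) ≈ N α⁻¹ + N β`. By
compactness such an `x` exists with uniform distances when the Gromov product of `α o` and `β o` is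
bounded (`IsMagnitude.exists_abs_sub_le`). Translating an intermediate point to `o` turns this into
additivity of `ψ`.

Properness of `ψ` means that `N` tends to infinity (`IsMagnitude.finite_setOf_le`). When `g n` and
its inverses have distinct limits, `g n` is eventually loxodromic with separated fixed points, so `N
(g n)` is close to `σ` at the attracting point and properness of `σ` applies. Equal limits are made
distinct by right multiplication with a fixed element, which exists because no boundary point is
fixed by all of `Γ` (`IsCompatibleMetric.exists_smul_ne`).

Finally, `N (γ β) - N β ≈ σ γ (β z)` for `z` away from `β⁻¹`, and `β z` tends to `ξ` when `β o`
does; coarse continuity gives `σ_ψ ≈ σ`. For the dual cocycle and `G`, the differences `ψ p (γ⁻¹ o)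
- ψ p o` and `ψ p o + ψ o q - ψ p q` are coarsely constant near the boundary, so their values at
chosen points serve as coarse limits.

The metric on `Γ ⊔ ∂X` is abstract; `BiConverges.eventually_lt_gromovProductPoint` ties it to the
geometry: if `g n` tends to `a` there, then `g n o` tends to `a` in `X ⊔ ∂X`. -/

theorem exists_strictMono_const_or_injective {α : Type*} (f : ℕ → α) :
    ∃ φ : ℕ → ℕ, StrictMono φ ∧ ((∃ a, ∀ n, f (φ n) = a) ∨ Function.Injective (f ∘ φ)) := by
  obtain ⟨φ, h | h⟩ := exists_increasing_or_nonincreasing_subseq (fun a b : α => a = b) f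
  · refine ⟨φ, φ.strictMono, Or.inl ⟨f (φ 0), fun n => ?_⟩⟩
    rcases Nat.eq_zero_or_pos n with rfl | hn
    · rfl
    · exact (h 0 n hn).symm
  · refine ⟨φ, φ.strictMono, Or.inr fun m n hmn => ?_⟩
    rcases lt_trichotomy m n with hlt | heq | hlt
    · exact absurd hmn (h m n hlt)
    · exact heq
    · exact absurd hmn.symm (h n m hlt)

namespace GroupUnion

theorem ofGroup_ne_ofPoint {Γ M : Type*} (g : Γ) (x : M) :
    (ofGroup g : GroupUnion Γ M) ≠ ofPoint x :=
  Sum.inl_ne_inr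

theorem ofPoint_injective {Γ M : Type*} : Function.Injective (ofPoint : M → GroupUnion Γ M) :=
  Sum.inr_injective

variable {Γ M : Type*} [Group Γ] [MulAction Γ M]

theorem smul_ofGroup (g h : Γ) : g • (ofGroup h : GroupUnion Γ M) = ofGroup (g * h) := rfl

theorem smul_ofPoint (g : Γ) (x : M) :
    g • (ofPoint x : GroupUnion Γ M) = ofPoint (g • x) := rfl

end GroupUnion

section Actions

variable {Γ M : Type*} [Group Γ] [TopologicalSpace M] [MulAction Γ M]

namespace ConvergesOff

theorem tendsto {g : ℕ → Γ} {x y z : M} (h : ConvergesOff g y x) {u : ℕ → M}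
    (hu : Tendsto u atTop (𝓝 z)) (hz : z ≠ y) :
    Tendsto (fun n => g n • u n) atTop (𝓝 x) :=
  (h z hz).comp (tendsto_id.prodMk hu)

theorem tendsto_const {g : ℕ → Γ} {x y z : M} (h : ConvergesOff g y x) (hz : z ≠ y) :
    Tendsto (fun n => g n • z) atTop (𝓝 x) :=
  h.tendsto tendsto_const_nhds hz

theorem comp {g : ℕ → Γ} {x y : M} (h : ConvergesOff g y x) {φ : ℕ → ℕ}
    (hφ : Tendsto φ atTop atTop) : ConvergesOff (g ∘ φ) y x := fun z hz =>
  (h z hz).comp ((hφ.comp tendsto_fst).prodMk tendsto_snd)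

end ConvergesOff

theorem IsLoxodromic.inv {γ : Γ} {a b : M} (h : IsLoxodromic γ a b) : IsLoxodromic γ⁻¹ b a where
  ne := h.ne.symm
  attracting_mem := h.repelling_mem
  repelling_mem := h.attracting_mem
  attracting_fixed := inv_smul_eq_iff.2 h.repelling_fixed.symm
  repelling_fixed := inv_smul_eq_iff.2 h.attracting_fixed.symm
  tendsto_attracting := h.tendsto_repelling
  tendsto_repelling := by simpa using h.tendsto_attracting

theorem IsLoxodromic.eq_or_eq_of_smul_eq [T2Space M] {γ : Γ} {a b z : M} (h : IsLoxodromic γ a b)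
    (hz : γ • z = z) : z = a ∨ z = b := by
  by_contra! hne
  have h1 := h.tendsto_attracting.tendsto_const hne.2
  have h2 : ∀ n : ℕ, γ ^ n • z = z := fun n => by
    induction n with
    | zero => simp
    | succ n ih => rw [pow_succ, mul_smul, hz, ih]
  simp only [h2] at h1
  exact hne.1 (tendsto_nhds_unique tendsto_const_nhds h1)

end Actions

open GroupUnion

variable {Γ M : Type*} [Group Γ] [MulAction Γ M] [MetricSpace (GroupUnion Γ M)]

/-- If the limit `x'` of the points `(g n)⁻¹ w` were not the exceptional point `y`, locally uniform
convergence would give `w = g n (g n)⁻¹ w → a`, impossible for `w` in `Γ`. -/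
theorem ConvergesOff.eq_of_inv {g : ℕ → Γ} {a : M} {y x' y' : GroupUnion Γ M}
    (h : ConvergesOff g y (ofPoint a)) (h' : ConvergesOff (fun n => (g n)⁻¹) y' x')
    (hg : Function.Injective g) : y = x' := by
  obtain ⟨w, hw⟩ : ∃ w : Γ, (ofGroup w : GroupUnion Γ M) ≠ y' := by
    by_contra! hall
    have : g 0 = g 1 := Sum.inl_injective ((hall (g 0)).trans (hall (g 1)).symm)
    exact zero_ne_one (hg this)
  by_contra hne
  have h1 := h.tendsto (h'.tendsto_const hw) (Ne.symm hne)
  simp only [smul_inv_smul] at h1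
  exact ofGroup_ne_ofPoint w a (tendsto_nhds_unique tendsto_const_nhds h1)

/-- `g n → a` locally uniformly off `b` and `(g n)⁻¹ → b` locally uniformly off `a`, on the
compactification `Γ ⊔ M`. -/
structure BiConverges (g : ℕ → Γ) (a b : M) : Prop where
  forward : ConvergesOff g (ofPoint b : GroupUnion Γ M) (ofPoint a)
  backward : ConvergesOff (fun n => (g n)⁻¹) (ofPoint a : GroupUnion Γ M) (ofPoint b)

namespace BiConverges

theorem inv {g : ℕ → Γ} {a b : M} (h : BiConverges g a b) :
    BiConverges (fun n => (g n)⁻¹) b a :=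
  ⟨h.backward, by simpa using h.forward⟩

theorem comp {g : ℕ → Γ} {a b : M} (h : BiConverges g a b) {φ : ℕ → ℕ}
    (hφ : Tendsto φ atTop atTop) : BiConverges (g ∘ φ) a b :=
  ⟨h.forward.comp hφ, h.backward.comp hφ⟩

theorem tendsto_ofGroup {g : ℕ → Γ} {a b : M} (h : BiConverges g a b) :
    Tendsto (fun n => (ofGroup (g n) : GroupUnion Γ M)) atTop (𝓝 (ofPoint a)) := by
  have := h.forward.tendsto_const (ofGroup_ne_ofPoint 1 b)
  simpa only [smul_ofGroup, mul_one] using this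

theorem tendsto_ofGroup_inv {g : ℕ → Γ} {a b : M} (h : BiConverges g a b) :
    Tendsto (fun n => (ofGroup (g n)⁻¹ : GroupUnion Γ M)) atTop (𝓝 (ofPoint b)) :=
  h.inv.tendsto_ofGroup

end BiConverges

namespace IsCompatibleMetric

variable [TopologicalSpace M] (hd : IsCompatibleMetric Γ M)
include hd

theorem t2Space : T2Space M := hd.point_embedding.t2Space

theorem tendsto_ofPoint_iff {ι : Type*} {l : Filter ι} {u : ι → M} {a : M} :
    Tendsto (fun i => (ofPoint (u i) : GroupUnion Γ M)) l (𝓝 (ofPoint a)) ↔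
      Tendsto u l (𝓝 a) :=
  hd.point_embedding.tendsto_nhds_iff.symm

theorem eventually_eq_of_tendsto_ofGroup {g : ℕ → Γ} {γ : Γ}
    (h : Tendsto (fun n => (ofGroup (g n) : GroupUnion Γ M)) atTop (𝓝 (ofGroup γ))) :
    ∀ᶠ n in atTop, g n = γ := by
  let _ : TopologicalSpace Γ := ⊥
  have : DiscreteTopology Γ := ⟨rfl⟩
  have h1 := hd.group_embedding.tendsto_nhds_iff.2 h
  rw [nhds_discrete] at h1
  exact tendsto_pure.1 h1

/-- Convergence of `g n * w` to an element of the discrete set `Γ` would make the sequence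
eventually constant. -/
theorem exists_eq_ofPoint {g : ℕ → Γ} (hg : Function.Injective g) {x y : GroupUnion Γ M}
    (h : ConvergesOff g y x) : ∃ a : M, x = ofPoint a := by
  rcases x with γ | a
  · exfalso
    obtain ⟨w, hw⟩ : ∃ w : Γ, (ofGroup w : GroupUnion Γ M) ≠ y := by
      by_contra! hall
      have : g 0 = g 1 := Sum.inl_injective ((hall (g 0)).trans (hall (g 1)).symm)
      exact zero_ne_one (hg this)
    have h1 : Tendsto (fun n => (ofGroup (g n * w) : GroupUnion Γ M)) atTop (𝓝 (ofGroup γ)) :=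
      h.tendsto_const hw
    obtain ⟨n, hn⟩ := eventually_atTop.1 (hd.eventually_eq_of_tendsto_ofGroup h1)
    have h2 := (hn n le_rfl).trans (hn (n + 1) n.le_succ).symm
    exact n.succ_ne_self (hg (mul_right_cancel h2)).symm
  · exact ⟨a, rfl⟩

theorem exists_biConverges {g : ℕ → Γ} (hg : Function.Injective g) :
    ∃ (a b : M) (φ : ℕ → ℕ), StrictMono φ ∧ BiConverges (g ∘ φ) a b := by
  obtain ⟨x, y, φ, hφ, h⟩ := hd.convergence.exists_subseq g hg
  have hg1 : Function.Injective fun n => (g (φ n))⁻¹ :=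
    inv_injective.comp (hg.comp hφ.injective)
  obtain ⟨x', y', ψ, hψ, h'⟩ := hd.convergence.exists_subseq _ hg1
  have hg2 := hg1.comp hψ.injective
  obtain ⟨a, rfl⟩ := hd.exists_eq_ofPoint (hg.comp hφ.injective) h
  obtain ⟨b, rfl⟩ := hd.exists_eq_ofPoint hg2 h'
  have h1 : ConvergesOff (g ∘ φ ∘ ψ) y (ofPoint a) := h.comp hψ.tendsto_atTop
  have e1 : y = ofPoint b := h1.eq_of_inv h'
    (hg.comp (hφ.comp hψ).injective)
  have e2 : y' = ofPoint a := h'.eq_of_inv (by simpa [Function.comp_def] using h1)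
    hg2
  subst e1 e2
  exact ⟨a, b, φ ∘ ψ, hφ.comp hψ, h1, h'⟩

/-- A dynamical criterion for being loxodromic. -/
theorem exists_isLoxodromic {γ : Γ} {U V : Set (GroupUnion Γ M)}
    (hUV : Disjoint (closure U) (closure V)) (hγ : ∀ w ∉ V, γ • w ∈ U)
    (hU1 : ofGroup 1 ∉ U) (hV1 : ofGroup 1 ∉ V) :
    ∃ a b : M, IsLoxodromic γ a b ∧ ofPoint a ∈ closure U ∧ ofPoint b ∈ closure V := by
  have hγ' : ∀ w ∉ U, γ⁻¹ • w ∈ V := fun w hw => by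
    by_contra hV
    exact hw (by simpa using hγ _ hV)
  have hUV' : Disjoint U V := hUV.mono subset_closure subset_closure
  have hpow : ∀ n : ℕ, ∀ w ∉ V, γ ^ (n + 1) • w ∈ U := fun n => by
    induction n with
    | zero => simpa using hγ
    | succ n ih =>
      intro w hw
      rw [pow_succ', mul_smul]
      exact hγ _ (disjoint_left.1 hUV' (ih w hw))
  have hpow' : ∀ n : ℕ, ∀ w ∉ U, (γ ^ (n + 1))⁻¹ • w ∈ V := fun n w hw => by
    by_contra hV
    exact hw (by simpa using hpow n _ hV)
  -- The identity lies outside `V`, so every positive power of `γ` lies in `U`, which misses the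
  -- identity: `γ` has infinite order.
  have hinj : Function.Injective fun n : ℕ => γ ^ n := by
    rw [injective_pow_iff_not_isOfFinOrder, isOfFinOrder_iff_pow_eq_one]
    rintro ⟨n, hn, h1⟩
    obtain ⟨m, rfl⟩ := Nat.exists_eq_succ_of_ne_zero hn.ne'
    have := hpow m _ hV1
    rw [← Nat.succ_eq_add_one, h1, one_smul] at this
    exact hU1 this
  -- Limits of powers of `γ` are fixed by `γ`, since `γ` commutes with its powers and the limit does
  -- not depend on the element of `Γ` to which they are applied.
  have key : ∀ p : ℕ → ℕ, Tendsto p atTop atTop → ∀ a b : M,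
      BiConverges (fun n => γ ^ p n) a b →
        ofPoint a ∈ closure U ∧ ofPoint b ∈ closure V ∧ γ • a = a ∧ γ • b = b := by
    intro p hp a b h
    have hp1 : ∀ᶠ n in atTop, ∃ m, p n = m + 1 := by
      filter_upwards [hp.eventually_ge_atTop 1] with n hn
      exact ⟨p n - 1, by omega⟩
    have := hd.t2Space
    refine ⟨?_, ?_, ?_, ?_⟩
    · refine mem_closure_of_tendsto (h.forward.tendsto_const (ofGroup_ne_ofPoint 1 b)) ?_
      filter_upwards [hp1] with n ⟨m, hm⟩
      rw [hm]
      exact hpow m _ hV1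
    · refine mem_closure_of_tendsto (h.backward.tendsto_const (ofGroup_ne_ofPoint 1 a)) ?_
      filter_upwards [hp1] with n ⟨m, hm⟩
      rw [hm]
      exact hpow' m _ hU1
    · have h1 := h.forward.tendsto_const (ofGroup_ne_ofPoint γ b)
      have h2 := ((hd.convergence.continuous_smul γ).tendsto _).comp
        (h.forward.tendsto_const (ofGroup_ne_ofPoint 1 b))
      refine ofPoint_injective (Γ := Γ) (tendsto_nhds_unique (h2.congr fun n => ?_) h1)
      simp only [Function.comp, smul_ofGroup, mul_one]
      rw [← pow_succ', pow_succ]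
    · have h1 := h.backward.tendsto_const (ofGroup_ne_ofPoint γ a)
      have h2 := ((hd.convergence.continuous_smul γ).tendsto _).comp
        (h.backward.tendsto_const (ofGroup_ne_ofPoint 1 a))
      refine ofPoint_injective (Γ := Γ) (tendsto_nhds_unique (h2.congr fun n => ?_) h1)
      simp only [Function.comp, smul_ofGroup, mul_one]
      congr 1
      exact ((Commute.refl γ).pow_right _).inv_right
  obtain ⟨a, b, φ, hφ, hab⟩ := hd.exists_biConverges hinj
  obtain ⟨ha, hb, hfa, hfb⟩ := key φ hφ.tendsto_atTop a b hab
  have hne : ∀ {a b : M}, (ofPoint a : GroupUnion Γ M) ∈ closure U →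
      (ofPoint b : GroupUnion Γ M) ∈ closure V → (ofPoint a : GroupUnion Γ M) ≠ ofPoint b :=
    fun ha hb e => disjoint_left.1 hUV ha (e ▸ hb)
  have hfix : ∀ {z : M}, γ • z = z → ∀ n : ℕ, γ ^ n • (ofPoint z : GroupUnion Γ M) = ofPoint z := by
    intro z hz n
    induction n with
    | zero => simp
    | succ n ih => rw [pow_succ, mul_smul, smul_ofPoint γ, hz, ih]
  -- The fixed point `a` lies in the closure of `U`, hence differs from `b'`; its constant orbit
  -- must therefore converge to `a'`. Uniqueness upgrades subsequential convergence to convergence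
  -- of all powers.
  have huniq : ∀ p : ℕ → ℕ, Tendsto p atTop atTop → ∀ a' b' : M,
      BiConverges (fun n => γ ^ p n) a' b' → a' = a ∧ b' = b := by
    intro p hp a' b' h
    obtain ⟨ha', hb', -, -⟩ := key p hp a' b' h
    have h1 := h.forward.tendsto_const (hne ha hb')
    simp only [hfix hfa] at h1
    have h2 := h.backward.tendsto_const (hne ha' hb).symm
    have e : ∀ n, (γ ^ p n)⁻¹ • (ofPoint b : GroupUnion Γ M) = ofPoint b := fun n =>
      inv_smul_eq_iff.2 (hfix hfb _).symm
    simp only [e] at h2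
    exact ⟨ofPoint_injective (Γ := Γ) (tendsto_nhds_unique h1 tendsto_const_nhds),
      ofPoint_injective (Γ := Γ) (tendsto_nhds_unique h2 tendsto_const_nhds)⟩
  have : FirstCountableTopology M := hd.point_embedding.isInducing.firstCountableTopology
  have hsub : ∀ p : ℕ → ℕ, Tendsto p atTop atTop → ∃ ψ : ℕ → ℕ, StrictMono ψ ∧
      BiConverges (fun n => γ ^ p (ψ n)) a b := by
    intro p hp
    obtain ⟨ψ, hψ, hpψ⟩ := strictMono_subseq_of_tendsto_atTop hp
    obtain ⟨a', b', χ, hχ, h⟩ := hd.exists_biConverges (hinj.comp hpψ.injective)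
    obtain ⟨rfl, rfl⟩ := huniq _ (hpψ.tendsto_atTop.comp hχ.tendsto_atTop) _ _ h
    exact ⟨ψ ∘ χ, hψ.comp hχ, h⟩
  have hfwd : ConvergesOff (fun n : ℕ => γ ^ n) b a := by
    intro z hz
    refine tendsto_of_seq_tendsto fun u hu => ?_
    rw [tendsto_prod_iff'] at hu
    refine tendsto_of_subseq_tendsto fun ns hns => ?_
    obtain ⟨ψ, hψ, h⟩ := hsub _ (hu.1.comp hns)
    refine ⟨ψ, ?_⟩
    rw [← hd.tendsto_ofPoint_iff]
    exact h.forward.tendsto (hd.tendsto_ofPoint_iff.2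
      (hu.2.comp (hns.comp hψ.tendsto_atTop))) (fun e => hz (ofPoint_injective e))
  have hbwd : ConvergesOff (fun n : ℕ => γ⁻¹ ^ n) a b := by
    intro z hz
    refine tendsto_of_seq_tendsto fun u hu => ?_
    rw [tendsto_prod_iff'] at hu
    refine tendsto_of_subseq_tendsto fun ns hns => ?_
    obtain ⟨ψ, hψ, h⟩ := hsub _ (hu.1.comp hns)
    refine ⟨ψ, ?_⟩
    rw [← hd.tendsto_ofPoint_iff]
    simp only [inv_pow]
    exact h.backward.tendsto (hd.tendsto_ofPoint_iff.2
      (hu.2.comp (hns.comp hψ.tendsto_atTop))) (fun e => hz (ofPoint_injective e))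
  exact ⟨a, b, ⟨fun e => hne ha hb (e ▸ rfl), ⟨_, _, hfwd⟩, ⟨_, _, hbwd⟩, hfa, hfb, hfwd, hbwd⟩,
    ha, hb⟩

theorem eventually_exists_isLoxodromic {g : ℕ → Γ} {a b : M} (h : BiConverges g a b)
    (hab : a ≠ b) {ε : ℝ} (hε : 0 < ε) :
    ∀ᶠ n in atTop, ∃ x y : M, IsLoxodromic (g n) x y ∧
      dist (ofPoint x : GroupUnion Γ M) (ofPoint a) ≤ ε ∧
      dist (ofPoint y : GroupUnion Γ M) (ofPoint b) ≤ ε := by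
  have := hd.convergence.compact
  have hab' : 0 < dist (ofPoint a : GroupUnion Γ M) (ofPoint b) :=
    dist_pos.2 fun e => hab (ofPoint_injective e)
  have ha1 : 0 < dist (ofGroup 1 : GroupUnion Γ M) (ofPoint a) :=
    dist_pos.2 (ofGroup_ne_ofPoint 1 a)
  have hb1 : 0 < dist (ofGroup 1 : GroupUnion Γ M) (ofPoint b) :=
    dist_pos.2 (ofGroup_ne_ofPoint 1 b)
  obtain ⟨η, hη, h1, h2, h3, h4⟩ : ∃ η > 0, η ≤ ε ∧
      η ≤ dist (ofPoint a : GroupUnion Γ M) (ofPoint b) / 3 ∧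
      η ≤ dist (ofGroup 1 : GroupUnion Γ M) (ofPoint a) ∧
      η ≤ dist (ofGroup 1 : GroupUnion Γ M) (ofPoint b) :=
    ⟨min (min ε (dist (ofPoint a : GroupUnion Γ M) (ofPoint b) / 3))
      (min (dist (ofGroup 1 : GroupUnion Γ M) (ofPoint a))
        (dist (ofGroup 1 : GroupUnion Γ M) (ofPoint b))), by positivity,
      (min_le_left _ _).trans (min_le_left _ _), (min_le_left _ _).trans (min_le_right _ _),
      (min_le_right _ _).trans (min_le_left _ _), (min_le_right _ _).trans (min_le_right _ _)⟩
  -- The complement of the ball is compact, so locally uniform convergence is uniform on it; this is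
  -- the ping-pong hypothesis of `exists_isLoxodromic`.
  have hunif : ∀ᶠ n in atTop, ∀ w ∉ Metric.ball (ofPoint b : GroupUnion Γ M) η,
      g n • w ∈ Metric.ball (ofPoint a : GroupUnion Γ M) η := by
    have hK : IsCompact (Metric.ball (ofPoint b : GroupUnion Γ M) η)ᶜ :=
      Metric.isOpen_ball.isClosed_compl.isCompact
    have hmem := hK.mem_prod_nhdsSet_of_forall (l := atTop)
      (s := {p : ℕ × GroupUnion Γ M | g p.1 • p.2 ∈ Metric.ball (ofPoint a) η}) fun w hw => by
        have hwb : w ≠ ofPoint b := fun e => hw (e ▸ Metric.mem_ball_self hη)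
        exact (h.forward w hwb).eventually (Metric.ball_mem_nhds _ hη)
    obtain ⟨t, ht, u, hu, htu⟩ := mem_prod_iff.1 hmem
    filter_upwards [ht] with n hn w hw
    exact htu (mk_mem_prod hn (subset_of_mem_nhdsSet hu hw))
  filter_upwards [hunif] with n hn
  obtain ⟨x, y, hl, hx, hy⟩ := hd.exists_isLoxodromic
    (U := Metric.ball (ofPoint a) η) (V := Metric.ball (ofPoint b) η)
    ((Metric.closedBall_disjoint_closedBall (by linarith)).mono
      Metric.closure_ball_subset_closedBall Metric.closure_ball_subset_closedBall) hn
    (by simpa using h3) (by simpa using h4)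
  exact ⟨x, y, hl, (Metric.mem_closedBall.1 (Metric.closure_ball_subset_closedBall hx)).trans h1,
    (Metric.mem_closedBall.1 (Metric.closure_ball_subset_closedBall hy)).trans h1⟩

end IsCompatibleMetric

end Dynamics

/-! ## Gromov products -/

section GromovProduct

variable {X : Type*} [MetricSpace X]

theorem gromovProduct_comm (o p q : X) : gromovProduct o p q = gromovProduct o q p := by
  simp only [gromovProduct, dist_comm p q]
  ring

theorem gromovProduct_self (o p : X) : gromovProduct o p p = dist o p := by
  simp [gromovProduct]

theorem gromovProduct_le_dist_left (o p q : X) : gromovProduct o p q ≤ dist o p := by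
  have := dist_triangle o p q
  simp only [gromovProduct]
  linarith

theorem gromovProduct_le_dist_right (o p q : X) : gromovProduct o p q ≤ dist o q := by
  rw [gromovProduct_comm]
  exact gromovProduct_le_dist_left o q p

theorem gromovProduct_nonneg (o p q : X) : 0 ≤ gromovProduct o p q := by
  have := dist_triangle_left p q o
  simp only [gromovProduct]
  linarith

theorem gromovProduct_le_add_left (o p p' q : X) :
    gromovProduct o p q ≤ gromovProduct o p' q + dist p p' := by
  have h1 := dist_triangle o p' p
  have h2 := dist_triangle p' p q
  rw [dist_comm p' p] at h1 h2
  simp only [gromovProduct]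
  linarith

theorem gromovProduct_le_add_right (o p q q' : X) :
    gromovProduct o p q ≤ gromovProduct o p q' + dist q q' := by
  rw [gromovProduct_comm o p q, gromovProduct_comm o p q']
  exact gromovProduct_le_add_left o q q' p

theorem gromovProduct_le_add_base (o o' p q : X) :
    gromovProduct o p q ≤ gromovProduct o' p q + dist o o' := by
  have h1 := dist_triangle o o' p
  have h2 := dist_triangle o o' q
  simp only [gromovProduct]
  linarith

theorem gromovProduct_add_gromovProduct (o p q : X) :
    gromovProduct o p q + gromovProduct p o q = dist o p := by
  simp only [gromovProduct, dist_comm p o]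
  ring

theorem gromovProduct_map (γ : X ≃ᵢ X) (o p q : X) :
    gromovProduct (γ o) (γ p) (γ q) = gromovProduct o p q := by
  simp only [gromovProduct, γ.dist_eq]

/-! ### Geodesic segments. -/

namespace IsGeodesicSegment

variable {s : Set X} {p q : X}

theorem dist_add_dist (h : IsGeodesicSegment s p q) {v : X} (hv : v ∈ s) :
    dist p v + dist v q = dist p q := by
  obtain ⟨c, hc, h0, h1, rfl⟩ := h
  obtain ⟨t, ht, rfl⟩ := hv
  have hp := hc 0 ⟨le_rfl, dist_nonneg⟩ t ht
  have hq := hc t ht _ ⟨dist_nonneg, le_rfl⟩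
  rw [h0, zero_sub, abs_neg, abs_of_nonneg ht.1] at hp
  rw [h1, abs_of_nonpos (by linarith [ht.2])] at hq
  rw [hp, hq]
  ring

theorem gromovProduct_le_dist (h : IsGeodesicSegment s p q) (w : X) {v : X} (hv : v ∈ s) :
    gromovProduct w p q ≤ dist w v := by
  have h1 := h.dist_add_dist hv
  have h2 := dist_triangle w v p
  have h3 := dist_triangle w v q
  rw [dist_comm v p] at h2
  simp only [gromovProduct]
  linarith

theorem exists_dist_eq (h : IsGeodesicSegment s p q) {t : ℝ} (h0 : 0 ≤ t) (ht : t ≤ dist p q) :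
    ∃ v ∈ s, dist p v = t := by
  obtain ⟨c, hc, hp, hq, rfl⟩ := h
  refine ⟨c t, ⟨t, ⟨h0, ht⟩, rfl⟩, ?_⟩
  have := hc 0 ⟨le_rfl, dist_nonneg⟩ t ⟨h0, ht⟩
  rwa [hp, zero_sub, abs_neg, abs_of_nonneg h0] at this

theorem left_mem (h : IsGeodesicSegment s p q) : p ∈ s := by
  obtain ⟨c, hc, hp, hq, rfl⟩ := h
  exact ⟨0, ⟨le_rfl, dist_nonneg⟩, hp⟩

theorem right_mem (h : IsGeodesicSegment s p q) : q ∈ s := by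
  obtain ⟨c, hc, hp, hq, rfl⟩ := h
  exact ⟨_, ⟨dist_nonneg, le_rfl⟩, hq⟩

theorem exists_continuousOn (h : IsGeodesicSegment s p q) :
    ∃ c : ℝ → X, ContinuousOn c (Icc 0 (dist p q)) ∧ s = c '' Icc 0 (dist p q) := by
  obtain ⟨c, hc, hp, hq, rfl⟩ := h
  refine ⟨c, ?_, rfl⟩
  refine (LipschitzOnWith.of_dist_le_mul (K := 1) fun t ht t' ht' => ?_).continuousOn
  rw [hc t ht t' ht', NNReal.coe_one, one_mul, Real.dist_eq]

theorem isCompact (h : IsGeodesicSegment s p q) : IsCompact s := by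
  obtain ⟨c, hc, rfl⟩ := h.exists_continuousOn
  exact isCompact_Icc.image_of_continuousOn hc

theorem isPreconnected (h : IsGeodesicSegment s p q) : IsPreconnected s := by
  obtain ⟨c, hc, rfl⟩ := h.exists_continuousOn
  exact isPreconnected_Icc.image c hc

end IsGeodesicSegment

variable (X) in
/-- The four-point inequality for Gromov products. -/
structure FourPoint (δ : ℝ) : Prop where
  nonneg : 0 ≤ δ
  le : ∀ w x y z : X,
    min (gromovProduct w x y) (gromovProduct w y z) - δ ≤ gromovProduct w x z

theorem FourPoint.lt {δ : ℝ} (h : FourPoint X δ) {w x y z : X} {R : ℝ}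
    (h1 : R < gromovProduct w x y) (h2 : R < gromovProduct w y z) :
    R - δ < gromovProduct w x z := by
  linarith [h.le w x y z, lt_min h1 h2]

/-- Slim triangles imply the four-point inequality. -/
theorem exists_fourPoint (hgeo : IsGeodesicSpace X) (hhyp : IsGromovHyperbolic X) :
    ∃ δ, FourPoint X δ := by
  obtain ⟨δ₀, hδ₀⟩ := hhyp
  obtain ⟨δ, hδ, hslim⟩ : ∃ δ : ℝ, 0 ≤ δ ∧ ∀ (p q r : X) (s₁ s₂ s₃ : Set X),
      IsGeodesicSegment s₁ p q → IsGeodesicSegment s₂ q r → IsGeodesicSegment s₃ r p →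
        ∀ u ∈ s₁, ∃ v ∈ s₂ ∪ s₃, dist u v ≤ δ := by
    refine ⟨max δ₀ 0, le_max_right _ _, fun p q r s₁ s₂ s₃ h₁ h₂ h₃ u hu => ?_⟩
    obtain ⟨v, hv, huv⟩ := hδ₀ p q r s₁ s₂ s₃ h₁ h₂ h₃ u hu
    exact ⟨v, hv, huv.trans (le_max_left _ _)⟩
  refine ⟨3 * δ, by positivity, fun w x y z => ?_⟩
  obtain ⟨s, hs⟩ := hgeo x z
  obtain ⟨s₂, hs₂⟩ := hgeo z w
  obtain ⟨s₃, hs₃⟩ := hgeo w x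
  obtain ⟨t₂, ht₂⟩ := hgeo z y
  obtain ⟨t₃, ht₃⟩ := hgeo y x
  -- The side `s` is connected and covered by the closed `δ`-neighbourhoods of the other two sides,
  -- each of which meets it; hence they meet on `s`. Such a `u` is within `2 * δ` of realizing the
  -- Gromov product as a distance from `w`.
  obtain ⟨u, hu, ⟨v, hv, huv⟩, ⟨v', hv', huv'⟩⟩ : ∃ u ∈ s, (∃ v ∈ s₂, dist u v ≤ δ) ∧
      ∃ v ∈ s₃, dist u v ≤ δ := by
    have hclosed : ∀ {t : Set X}, IsCompact t → IsClosed {u | ∃ v ∈ t, dist u v ≤ δ} := by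
      intro t ht
      have : {u | ∃ v ∈ t, dist u v ≤ δ} = Metric.cthickening δ t := by
        rw [ht.cthickening_eq_biUnion_closedBall hδ]
        ext u
        simp
      rw [this]
      exact Metric.isClosed_cthickening
    have hpre := isPreconnected_closed_iff.1 hs.isPreconnected _ _ (hclosed hs₂.isCompact)
      (hclosed hs₃.isCompact)
    obtain ⟨u, hu, h⟩ := hpre (fun u hu => by
        obtain ⟨v, hv | hv, huv⟩ := hslim x z w s s₂ s₃ hs hs₂ hs₃ u hu
        · exact Or.inl ⟨v, hv, huv⟩
        · exact Or.inr ⟨v, hv, huv⟩)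
      ⟨z, hs.right_mem, z, hs₂.left_mem, by simpa using hδ⟩
      ⟨x, hs.left_mem, x, hs₃.right_mem, by simpa using hδ⟩
    exact ⟨u, hu, h⟩
  have hwu : dist w u ≤ gromovProduct w x z + 2 * δ := by
    have e := hs.dist_add_dist hu
    have e₂ := hs₂.dist_add_dist hv
    have e₃ := hs₃.dist_add_dist hv'
    have i₁ := dist_triangle w v u
    have i₂ := dist_triangle z v u
    have i₃ := dist_triangle w v' u
    have i₄ := dist_triangle x v' u
    simp only [gromovProduct]
    linarith [dist_comm x w, dist_comm z w, dist_comm u v, dist_comm u v', dist_comm v w,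
      dist_comm x v', dist_comm x u, dist_comm z u]
  obtain ⟨v₀, hv₀, huv₀⟩ := hslim x z y s t₂ t₃ hs ht₂ ht₃ u hu
  have hw : dist w v₀ ≤ dist w u + δ := (dist_triangle w u v₀).trans (by linarith)
  rcases hv₀ with hv₀ | hv₀
  · have h1 := ht₂.gromovProduct_le_dist w hv₀
    rw [gromovProduct_comm] at h1
    linarith [min_le_right (gromovProduct w x y) (gromovProduct w y z)]
  · have h1 := ht₃.gromovProduct_le_dist w hv₀
    rw [gromovProduct_comm] at h1
    linarith [min_le_left (gromovProduct w x y) (gromovProduct w y z)]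

end GromovProduct

/-! ## The Gromov boundary -/

section Boundary

variable {X : Type*} [MetricSpace X]

/-- The endpoint of a geodesic ray. -/
def GeodesicRay.endpoint (c : GeodesicRay X) : GromovBoundary X :=
  Quotient.mk (GeodesicRay.setoid X) c

namespace GeodesicRay

theorem exists_endpoint_eq (ξ : GromovBoundary X) : ∃ c : GeodesicRay X, c.endpoint = ξ :=
  Quotient.exists_rep ξ

theorem exists_dist_le {c c' : GeodesicRay X} (h : c.endpoint = c'.endpoint) :
    ∃ C : ℝ, ∀ t, dist (c.1 t) (c'.1 t) ≤ C :=
  Quotient.exact h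

theorem dist_eq (c : GeodesicRay X) (s t : ℝ≥0) : dist (c.1 s) (c.1 t) = |(s : ℝ) - t| := by
  rw [c.2.dist_eq, NNReal.dist_eq]

theorem dist_zero (c : GeodesicRay X) (t : ℝ≥0) : dist (c.1 0) (c.1 t) = t := by
  rw [c.dist_eq]
  simp

theorem le_dist (c : GeodesicRay X) (o : X) (t : ℝ≥0) :
    (t : ℝ) - dist o (c.1 0) ≤ dist o (c.1 t) := by
  have h1 := dist_triangle (c.1 0) o (c.1 t)
  linarith [c.dist_zero t, dist_comm o (c.1 0)]

theorem dist_le (c : GeodesicRay X) (o : X) (t : ℝ≥0) :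
    dist o (c.1 t) ≤ t + dist o (c.1 0) := by
  have h1 := dist_triangle o (c.1 0) (c.1 t)
  linarith [c.dist_zero t]

theorem min_sub_le_gromovProduct (c : GeodesicRay X) (o : X) (s t : ℝ≥0) :
    min (s : ℝ) t - dist o (c.1 0) ≤ gromovProduct o (c.1 s) (c.1 t) := by
  have h1 := c.le_dist o s
  have h2 := c.le_dist o t
  simp only [gromovProduct, c.dist_eq]
  rcases le_total (s : ℝ) t with h | h
  · rw [min_eq_left h, abs_of_nonpos (by linarith)]
    linarith
  · rw [min_eq_right h, abs_of_nonneg (by linarith)]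
    linarith

theorem eventually_coe_gt (R : ℝ) : ∀ᶠ t : ℝ≥0 in atTop, R < t :=
  (NNReal.tendsto_coe_atTop.2 tendsto_id).eventually_gt_atTop R

theorem eventually_lt_gromovProduct {c c' : GeodesicRay X} (h : c.endpoint = c'.endpoint) (o : X)
    (R : ℝ) : ∀ᶠ t : ℝ≥0 × ℝ≥0 in atTop ×ˢ atTop, R < gromovProduct o (c.1 t.1) (c'.1 t.2) := by
  obtain ⟨C, hC⟩ := exists_dist_le h
  have hR := eventually_coe_gt (R + dist o (c.1 0) + C)
  filter_upwards [hR.prod_mk hR] with t ht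
  have h1 := c.min_sub_le_gromovProduct o t.1 t.2
  have h2 := gromovProduct_le_add_right o (c.1 t.1) (c.1 t.2) (c'.1 t.2)
  linarith [hC t.2, lt_min ht.1 ht.2]

theorem eventually_lt_gromovProduct_diag {c c' : GeodesicRay X} (h : c.endpoint = c'.endpoint)
    (o : X) (R : ℝ) : ∀ᶠ t : ℝ≥0 in atTop, R < gromovProduct o (c.1 t) (c'.1 t) :=
  (tendsto_id.prodMk tendsto_id).eventually (eventually_lt_gromovProduct h o R)

end GeodesicRay

open GeodesicRay

theorem le_gromovProductPoint {o p : X} {R : ℝ} {c : GeodesicRay X}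
    (h : ∀ᶠ t in atTop, R ≤ gromovProduct o (c.1 t) p) :
    (R : EReal) ≤ gromovProductPoint o c.endpoint p := by
  refine le_iSup₂_of_le c rfl (le_liminf_of_le (by isBoundedDefault) ?_)
  filter_upwards [h] with t ht
  exact_mod_cast ht

theorem lt_gromovProductPoint {o p : X} {R R' : ℝ} (hR : R < R') {c : GeodesicRay X}
    (h : ∀ᶠ t in atTop, R' ≤ gromovProduct o (c.1 t) p) :
    (R : EReal) < gromovProductPoint o c.endpoint p :=
  (EReal.coe_lt_coe_iff.2 hR).trans_le (le_gromovProductPoint h)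

theorem exists_ray_of_lt_gromovProductPoint {o p : X} {ξ : GromovBoundary X} {R : ℝ}
    (h : (R : EReal) < gromovProductPoint o ξ p) :
    ∃ c : GeodesicRay X, c.endpoint = ξ ∧ ∀ᶠ t in atTop, R < gromovProduct o (c.1 t) p := by
  obtain ⟨c, h⟩ := lt_iSup_iff.1 h
  obtain ⟨hc, h⟩ := lt_iSup_iff.1 h
  refine ⟨c, hc, ?_⟩
  filter_upwards [eventually_lt_of_lt_liminf h (by isBoundedDefault)] with t ht
  exact_mod_cast ht

theorem lt_dist_of_lt_gromovProductPoint {o p : X} {ξ : GromovBoundary X} {R : ℝ}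
    (h : (R : EReal) < gromovProductPoint o ξ p) : R < dist o p := by
  obtain ⟨c, -, hc⟩ := exists_ray_of_lt_gromovProductPoint h
  obtain ⟨t, ht⟩ := hc.exists
  exact ht.trans_le (gromovProduct_le_dist_right _ _ _)

theorem lt_gromovProductBoundary {o : X} {R R' : ℝ} (hR : R < R') {c c' : GeodesicRay X}
    (h : ∀ᶠ t : ℝ≥0 × ℝ≥0 in atTop ×ˢ atTop, R' ≤ gromovProduct o (c.1 t.1) (c'.1 t.2)) :
    (R : EReal) < gromovProductBoundary o c.endpoint c'.endpoint := by
  refine (EReal.coe_lt_coe_iff.2 hR).trans_le ?_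
  refine le_iSup₂_of_le c rfl (le_iSup₂_of_le c' rfl (le_liminf_of_le (by isBoundedDefault) ?_))
  filter_upwards [h] with t ht
  exact_mod_cast ht

theorem exists_ray_of_lt_gromovProductBoundary {o : X} {ξ η : GromovBoundary X} {R : ℝ}
    (h : (R : EReal) < gromovProductBoundary o ξ η) :
    ∃ c c' : GeodesicRay X, c.endpoint = ξ ∧ c'.endpoint = η ∧
      ∀ᶠ t : ℝ≥0 × ℝ≥0 in atTop ×ˢ atTop, R < gromovProduct o (c.1 t.1) (c'.1 t.2) := by
  obtain ⟨c, h⟩ := lt_iSup_iff.1 h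
  obtain ⟨hc, h⟩ := lt_iSup_iff.1 h
  obtain ⟨c', h⟩ := lt_iSup_iff.1 h
  obtain ⟨hc', h⟩ := lt_iSup_iff.1 h
  refine ⟨c, c', hc, hc', ?_⟩
  filter_upwards [eventually_lt_of_lt_liminf h (by isBoundedDefault)] with t ht
  exact_mod_cast ht

theorem gromovProductPoint_smul (γ : X ≃ᵢ X) (o p : X) (ξ : GromovBoundary X) :
    gromovProductPoint o ξ p ≤ gromovProductPoint (γ o) (γ • ξ) (γ p) := by
  refine iSup₂_le fun c hc => le_iSup₂_of_le (c.map γ) ?_ (le_of_eq ?_)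
  · rw [← hc]
    rfl
  · simp only [GeodesicRay.map, gromovProduct_map]

theorem lt_gromovProductPoint_self (c : GeodesicRay X) (o : X) (R : ℝ) :
    ∀ᶠ t in atTop, (R : EReal) < gromovProductPoint o c.endpoint (c.1 t) := by
  filter_upwards [eventually_coe_gt (R + 1 + dist o (c.1 0))] with t ht
  refine lt_gromovProductPoint (lt_add_one R) ?_
  filter_upwards [eventually_ge_atTop t] with s hs
  have h1 := c.min_sub_le_gromovProduct o s t
  rw [min_eq_right (NNReal.coe_le_coe.2 hs)] at h1
  linarith

theorem lt_gromovProductPoint_base {o o' p : X} {ξ : GromovBoundary X} {R : ℝ}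
    (h : ((R + dist o o' + 1 : ℝ) : EReal) < gromovProductPoint o ξ p) :
    (R : EReal) < gromovProductPoint o' ξ p := by
  obtain ⟨c, rfl, hc⟩ := exists_ray_of_lt_gromovProductPoint h
  refine lt_gromovProductPoint (lt_add_one R) ?_
  filter_upwards [hc] with t ht
  linarith [gromovProduct_le_add_base o o' (c.1 t) p]

theorem lt_gromovProductBoundary_base {o o' : X} {ξ η : GromovBoundary X} {R : ℝ}
    (h : ((R + dist o o' + 1 : ℝ) : EReal) < gromovProductBoundary o ξ η) :
    (R : EReal) < gromovProductBoundary o' ξ η := by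
  obtain ⟨c, c', rfl, rfl, hc⟩ := exists_ray_of_lt_gromovProductBoundary h
  refine lt_gromovProductBoundary (lt_add_one R) ?_
  filter_upwards [hc] with t ht
  linarith [gromovProduct_le_add_base o o' (c.1 t.1) (c'.1 t.2)]

theorem lt_gromovProductBoundary_self (o : X) (ξ : GromovBoundary X) (R : ℝ) :
    (R : EReal) < gromovProductBoundary o ξ ξ := by
  obtain ⟨c, rfl⟩ := exists_endpoint_eq ξ
  refine lt_gromovProductBoundary (lt_add_one R) ?_
  filter_upwards [eventually_lt_gromovProduct (rfl : c.endpoint = c.endpoint) o (R + 1)] with t ht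
  exact ht.le

theorem exists_not_lt_gromovProductBoundary [T1Space (GromovBoundary X)] (o : X)
    {ξ η : GromovBoundary X} (h : ξ ≠ η) :
    ∃ K : ℝ, ¬ (K : EReal) < gromovProductBoundary o ξ η := by
  obtain ⟨K, hK⟩ := (isOpen_compl_singleton (x := η)) ξ h o
  exact ⟨K, fun hlt => hK η hlt rfl⟩

/-- Changing the base point changes products by a bounded amount, so the sets at a single `o`
already form a basis. -/
theorem GromovBoundary.mem_nhdsIn_iff {o : X} {ξ : GromovBoundary X} {s : Set X} :
    s ∈ ξ.nhdsIn ↔ ∃ R : ℝ, ∀ p, (R : EReal) < gromovProductPoint o ξ p → p ∈ s := by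
  have h : ξ.nhdsIn = ⨅ R : ℝ, 𝓟 {p : X | (R : EReal) < gromovProductPoint o ξ p} := by
    refine le_antisymm (iInf_le _ o) (le_iInf₂ fun o' R => ?_)
    refine (iInf_le _ (R + dist o o' + 1)).trans (principal_mono.2 fun p hp => ?_)
    exact lt_gromovProductPoint_base hp
  rw [h, (hasBasis_iInf_principal ?_).mem_iff]
  · simp only [true_and, Set.subset_def, mem_ofPred_eq]
  · intro R R'
    refine ⟨max R R', fun p hp => ?_, fun p hp => ?_⟩
    · exact lt_of_le_of_lt (EReal.coe_le_coe_iff.2 (le_max_left R R')) (mem_ofPred_eq ▸ hp :)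
    · exact lt_of_le_of_lt (EReal.coe_le_coe_iff.2 (le_max_right R R')) (mem_ofPred_eq ▸ hp :)

instance GromovBoundary.nhdsIn_neBot (ξ : GromovBoundary X) : ξ.nhdsIn.NeBot := by
  obtain ⟨c, rfl⟩ := exists_endpoint_eq ξ
  rw [neBot_iff, ne_eq, ← empty_mem_iff_bot, mem_nhdsIn_iff (o := c.1 0)]
  rintro ⟨R, hR⟩
  obtain ⟨t, ht⟩ := (lt_gromovProductPoint_self c (c.1 0) R).exists
  exact hR _ ht

theorem GromovBoundary.eventually_lt_gromovProductPoint (o : X) (ξ : GromovBoundary X) (R : ℝ) :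
    ∀ᶠ p in ξ.nhdsIn, (R : EReal) < gromovProductPoint o ξ p :=
  mem_nhdsIn_iff.2 ⟨R, fun _ h => h⟩

theorem GromovBoundary.tendsto_smul_nhdsIn (γ : X ≃ᵢ X) (ξ : GromovBoundary X) :
    Tendsto γ ξ.nhdsIn (γ • ξ).nhdsIn := by
  obtain ⟨c, rfl⟩ := exists_endpoint_eq ξ
  intro s hs
  obtain ⟨R, hR⟩ := (mem_nhdsIn_iff (o := γ (c.1 0))).1 hs
  exact (mem_nhdsIn_iff (o := c.1 0)).2
    ⟨R, fun p hp => hR _ (hp.trans_le (gromovProductPoint_smul γ _ p _))⟩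

/-! ### The four-point inequality at the boundary. -/

namespace FourPoint

variable {δ : ℝ} (hX : FourPoint X δ)
include hX

/-- The boundary product is a supremum over representing rays; at the cost of `δ` any prescribed ray
may be used instead. -/
theorem eventually_ray {o p : X} {R : ℝ} {c : GeodesicRay X}
    (h : (R : EReal) < gromovProductPoint o c.endpoint p) :
    ∀ᶠ t in atTop, R - δ < gromovProduct o (c.1 t) p := by
  obtain ⟨c', hc', h'⟩ := exists_ray_of_lt_gromovProductPoint h
  filter_upwards [h', eventually_lt_gromovProduct_diag hc'.symm o R] with t ht ht'
  exact hX.lt ht' ht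

theorem eventually_ray_prod {o : X} {R : ℝ} {c c' : GeodesicRay X}
    (h : (R : EReal) < gromovProductBoundary o c.endpoint c'.endpoint) :
    ∀ᶠ t : ℝ≥0 × ℝ≥0 in atTop ×ˢ atTop,
      R - 2 * δ < gromovProduct o (c.1 t.1) (c'.1 t.2) := by
  obtain ⟨d, d', hd, hd', h'⟩ := exists_ray_of_lt_gromovProductBoundary h
  have h1 := (eventually_lt_gromovProduct_diag hd.symm o R).prod_inl (atTop : Filter ℝ≥0)
  have h2 := (eventually_lt_gromovProduct_diag hd' o (R - δ)).prod_inr (atTop : Filter ℝ≥0)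
  filter_upwards [h', h1, h2] with t ht ht1 ht2
  linarith [hX.lt (hX.lt ht1 ht) ht2]

theorem lt_gromovProduct_of_point {o p q : X} {ξ : GromovBoundary X} {R : ℝ}
    (hp : (R : EReal) < gromovProductPoint o ξ p) (hq : (R : EReal) < gromovProductPoint o ξ q) :
    R - 2 * δ < gromovProduct o p q := by
  obtain ⟨c, rfl⟩ := exists_endpoint_eq ξ
  obtain ⟨t, h1, h2⟩ := ((hX.eventually_ray hp).and (hX.eventually_ray hq)).exists
  rw [gromovProduct_comm] at h1
  linarith [hX.lt h1 h2]

theorem lt_gromovProductPoint_of_boundary {o p : X} {ξ η : GromovBoundary X} {R : ℝ}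
    (h : (R : EReal) < gromovProductBoundary o ξ η)
    (hp : (R : EReal) < gromovProductPoint o η p) :
    ((R - 4 * δ - 1 : ℝ) : EReal) < gromovProductPoint o ξ p := by
  obtain ⟨c, rfl⟩ := exists_endpoint_eq ξ
  obtain ⟨c', rfl⟩ := exists_endpoint_eq η
  refine lt_gromovProductPoint (R' := R - 4 * δ) (by linarith) ?_
  filter_upwards [(hX.eventually_ray_prod h).curry] with t ht
  obtain ⟨s, h1, h2⟩ := (ht.and (hX.eventually_ray hp)).exists
  have h3 : R - 2 * δ < gromovProduct o (c'.1 s) p := by linarith [hX.nonneg]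
  linarith [hX.lt h1 h3, hX.nonneg]

theorem lt_gromovProductBoundary_trans {o : X} {ξ η ζ : GromovBoundary X} {R : ℝ}
    (h : (R : EReal) < gromovProductBoundary o ξ η)
    (h' : (R : EReal) < gromovProductBoundary o η ζ) :
    ((R - 3 * δ - 1 : ℝ) : EReal) < gromovProductBoundary o ξ ζ := by
  obtain ⟨c, rfl⟩ := exists_endpoint_eq ξ
  obtain ⟨c', rfl⟩ := exists_endpoint_eq η
  obtain ⟨c'', rfl⟩ := exists_endpoint_eq ζ
  refine lt_gromovProductBoundary (R' := R - 3 * δ) (by linarith) ?_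
  have h1 := (hX.eventually_ray_prod h)
  have h2 := (hX.eventually_ray_prod h')
  obtain ⟨a, ha, b, hb, hab⟩ := eventually_prod_iff.1 h1
  obtain ⟨a', ha', b', hb', hab'⟩ := eventually_prod_iff.1 h2
  obtain ⟨s, hs, hs'⟩ := (hb.and ha').exists
  filter_upwards [ha.prod_mk hb'] with t ht
  linarith [hX.lt (hab ht.1 hs) (hab' hs' ht.2)]

theorem lt_gromovProductBoundary_of_point {o p q : X} {ξ η : GromovBoundary X} {R : ℝ}
    (hp : (R : EReal) < gromovProductPoint o ξ p) (hq : (R : EReal) < gromovProductPoint o η q)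
    (hpq : R < gromovProduct o p q) :
    ((R - 3 * δ - 1 : ℝ) : EReal) < gromovProductBoundary o ξ η := by
  obtain ⟨c, rfl⟩ := exists_endpoint_eq ξ
  obtain ⟨c', rfl⟩ := exists_endpoint_eq η
  refine lt_gromovProductBoundary (R' := R - 3 * δ) (by linarith) ?_
  filter_upwards [(hX.eventually_ray hp).prod_mk (hX.eventually_ray hq)] with t ht
  have h1 : R - δ < gromovProduct o p q := by linarith [hX.nonneg]
  have h2 := ht.2
  rw [gromovProduct_comm] at h2
  have h3 : R - δ - δ < gromovProduct o q (c'.1 t.2) := by linarith [hX.nonneg]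
  linarith [hX.lt (hX.lt ht.1 h1) h3]

theorem setOf_lt_gromovProductBoundary_mem_nhds (o : X) (ξ : GromovBoundary X) (R : ℝ) :
    {η | (R : EReal) < gromovProductBoundary o ξ η} ∈ 𝓝 ξ := by
  -- The set itself need not be open. The open set used consists of the points having a whole
  -- product-neighbourhood inside it; its openness is the coarse transitivity of large products.
  refine mem_nhds_iff.2 ⟨{η | ∃ R' : ℝ, ∀ ζ, (R' : EReal) < gromovProductBoundary o η ζ →
    (R : EReal) < gromovProductBoundary o ξ ζ}, fun η ⟨R', h⟩ =>
      h η (lt_gromovProductBoundary_self o η R'), fun η ⟨R', h⟩ o' => ?_, R, fun _ h => h⟩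
  refine ⟨R' + 3 * δ + 1 + dist o' o + 1, fun ζ hζ => ⟨R' + 3 * δ + 1, fun ω hω => h ω ?_⟩⟩
  have := hX.lt_gromovProductBoundary_trans (lt_gromovProductBoundary_base hζ) hω
  rwa [show R' + 3 * δ + 1 - 3 * δ - 1 = R' by ring] at this

/-- Makes coarse limits at nearby boundary points comparable: one point of `X` can be chosen close
to both. This yields coarse continuity and local boundedness. -/
theorem eventually_eventually_nhdsIn {ξ : GromovBoundary X} {P : X → Prop}
    (h : ∀ᶠ p in ξ.nhdsIn, P p) : ∀ᶠ η in 𝓝 ξ, ∀ᶠ p in η.nhdsIn, P p := by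
  obtain ⟨c, -⟩ := exists_endpoint_eq ξ
  obtain ⟨R, hR⟩ := (GromovBoundary.mem_nhdsIn_iff (o := c.1 0)).1 h
  filter_upwards [hX.setOf_lt_gromovProductBoundary_mem_nhds (c.1 0) ξ (R + 4 * δ + 1)] with η hη
  refine (GromovBoundary.mem_nhdsIn_iff (o := c.1 0)).2 ⟨R + 4 * δ + 1, fun p hp => hR p ?_⟩
  have := hX.lt_gromovProductPoint_of_boundary hη hp
  rwa [show R + 4 * δ + 1 - 4 * δ - 1 = R by ring] at this

end FourPoint

end Boundary

/-! ## Comparison of `Γ ⊔ ∂X` with the orbit of a base point -/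

section Orbit

open GroupUnion GeodesicRay

theorem gromovProduct_sub_le {X : Type*} [MetricSpace X] (o w p q : X) :
    gromovProduct o p q - gromovProduct w p q ≤ gromovProduct o p w := by
  have h1 := dist_triangle o w q
  simp only [gromovProduct]
  linarith [dist_comm w p]

theorem IsNonelementary.exists_three {Γ M : Type*} [Group Γ] [TopologicalSpace M] [MulAction Γ M]
    (h : IsNonelementary Γ M) : ∃ x y z : M, x ≠ y ∧ x ≠ z ∧ y ≠ z := by
  obtain ⟨t, -, ht⟩ := exists_subset_encard_eq h
  obtain ⟨x, y, z, h1, h2, h3, -⟩ := encard_eq_three.1 ht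
  exact ⟨x, y, z, h1, h2, h3⟩

theorem IsNonelementary.exists_pair_ne {Γ M : Type*} [Group Γ] [TopologicalSpace M]
    [MulAction Γ M] (h : IsNonelementary Γ M) (b : M) : ∃ x y : M, x ≠ y ∧ x ≠ b ∧ y ≠ b := by
  obtain ⟨x, y, z, hxy, hxz, hyz⟩ := h.exists_three
  by_cases hx : x = b
  · subst hx
    exact ⟨y, z, hyz, hxy.symm, hxz.symm⟩
  · by_cases hy : y = b
    · subst hy
      exact ⟨x, z, hxz, hxy, hyz.symm⟩
    · exact ⟨x, y, hxy, hx, hy⟩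

/-- If `Γ` fixes two points, these are all of its limit set. -/
theorem IsNonelementary.exists_smul_ne_or {Γ M : Type*} [Group Γ] [TopologicalSpace M] [T2Space M]
    [MulAction Γ M] (h : IsNonelementary Γ M) {a b : M} (hab : a ≠ b) :
    ∃ γ : Γ, γ • a ≠ a ∨ γ • b ≠ b := by
  by_contra! hfix
  have hsub : limitSet Γ M ⊆ {a, b} := by
    rintro x ⟨y, g, hg⟩
    by_cases hy : a = y
    · have h1 := hg.tendsto_const (z := b) (fun e => hab (hy.trans e.symm))
      simp only [(hfix _).2] at h1
      exact Or.inr (tendsto_nhds_unique h1 tendsto_const_nhds)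
    · have h1 := hg.tendsto_const (z := a) hy
      simp only [(hfix _).1] at h1
      exact Or.inl (tendsto_nhds_unique h1 tendsto_const_nhds)
  have h1 := h.trans (encard_le_encard hsub)
  rw [encard_pair hab] at h1
  exact absurd h1 (by norm_num)

variable {X : Type*} [MetricSpace X] {Γ : Subgroup (X ≃ᵢ X)}

theorem IsCocompact.exists_dist_le (h : IsCocompact Γ) (o : X) :
    ∃ R : ℝ, ∀ p : X, ∃ γ : Γ, dist p (γ.1 o) ≤ R := by
  obtain ⟨K, hK, hcov⟩ := h
  obtain ⟨R, hR⟩ := hK.isBounded.subset_closedBall o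
  refine ⟨R, fun p => ?_⟩
  obtain ⟨γ, hγ, k, hk, rfl⟩ := hcov p
  exact ⟨⟨γ, hγ⟩, (γ.dist_eq k o).trans_le (hR hk)⟩

theorem Subgroup.dist_coe_inv_apply (γ : Γ) (p q : X) :
    dist (γ⁻¹.1 p) q = dist p (γ.1 q) := by
  rw [← γ.1.dist_eq, ← IsometryEquiv.mul_apply]
  simp

variable [MetricSpace (GroupUnion Γ (GromovBoundary X))]
  (hd : IsCompatibleMetric Γ (GromovBoundary X)) (hne : IsNonelementary Γ (GromovBoundary X))
  {δ : ℝ} (hX : FourPoint X δ)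

include hd hne hX in
-- Take distinct `z`, `z'` other than `b`. Their images under `g n` both approach `a`, so they have
-- a large product seen from `o`, whereas seen from `g n o` it is the product of `z`, `z'` seen from
-- `o`, which is bounded. By `gromovProduct_sub_le` the point `g n o` must lie in the same direction
-- as these images.
theorem BiConverges.eventually_lt_gromovProductPoint {g : ℕ → Γ} {a b : GromovBoundary X}
    (h : BiConverges g a b) (o : X) (R : ℝ) :
    ∀ᶠ n in atTop, (R : EReal) < gromovProductPoint o a ((g n).1 o) := by
  have := hd.t2Space
  obtain ⟨z, z', hzz, hz, hz'⟩ := hne.exists_pair_ne b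
  obtain ⟨K, hK⟩ := exists_not_lt_gromovProductBoundary o hzz
  obtain ⟨c, rfl⟩ := exists_endpoint_eq z
  obtain ⟨c', rfl⟩ := exists_endpoint_eq z'
  obtain ⟨d, rfl⟩ := exists_endpoint_eq a
  have hfreq : ∃ᶠ t : ℝ≥0 × ℝ≥0 in atTop ×ˢ atTop,
      gromovProduct o (c.1 t.1) (c'.1 t.2) < K + 1 := by
    intro hev
    refine hK (lt_gromovProductBoundary (lt_add_one K) ?_)
    filter_upwards [hev] with t ht
    exact not_lt.1 ht
  have htend : ∀ z : GromovBoundary X, z ≠ b →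
      Tendsto (fun n => g n • z) atTop (𝓝 d.endpoint) := fun z hz =>
    hd.tendsto_ofPoint_iff.1 (h.forward.tendsto_const fun e => hz (ofPoint_injective e))
  have hnhds := hX.setOf_lt_gromovProductBoundary_mem_nhds o d.endpoint (R + 4 * δ + K + 2)
  filter_upwards [(htend _ hz).eventually hnhds, (htend _ hz').eventually hnhds] with n h1 h2
  have h1' := (hX.eventually_ray_prod (c := d) (c' := c.map (g n).1) h1).curry
  have h2' := (hX.eventually_ray_prod (c := d) (c' := c'.map (g n).1) h2).curry
  refine lt_gromovProductPoint (lt_add_one R) ?_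
  filter_upwards [h1', h2'] with s hs hs'
  obtain ⟨t, ht, ht1, ht2⟩ := (hfreq.and_eventually (hs.prod_mk hs')).exists
  rw [gromovProduct_comm] at ht1
  have h3 := hX.lt ht1 ht2
  have h4 : gromovProduct ((g n).1 o) ((c.map (g n).1).1 t.1) ((c'.map (g n).1).1 t.2) =
    gromovProduct o (c.1 t.1) (c'.1 t.2) := gromovProduct_map (g n).1 o (c.1 t.1) (c'.1 t.2)
  have h5 := gromovProduct_sub_le o ((g n).1 o) ((c.map (g n).1).1 t.1) ((c'.map (g n).1).1 t.2)
  have h6 := gromovProduct_nonneg o (c.1 t.1) (c'.1 t.2)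
  rw [gromovProduct_comm] at ht1
  have h7 : R + 1 + δ < gromovProduct o (d.1 s) ((c.map (g n).1).1 t.1) := by
    linarith [hX.nonneg]
  have h8 : R + 1 + δ < gromovProduct o ((c.map (g n).1).1 t.1) ((g n).1 o) := by
    linarith
  linarith [hX.lt h7 h8]

include hd hne hX in
/-- `Γ` acts properly discontinuously. -/
theorem IsCompatibleMetric.finite_setOf_dist_le (o : X) (C : ℝ) :
    {γ : Γ | dist o (γ.1 o) ≤ C}.Finite := by
  by_contra hinf
  obtain ⟨a, b, φ, hφ, h⟩ := hd.exists_biConverges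
    (g := fun n => ((Set.Infinite.natEmbedding _ hinf n : {γ : Γ | dist o (γ.1 o) ≤ C}) : Γ))
    (Subtype.val_injective.comp (Set.Infinite.natEmbedding _ hinf).injective)
  obtain ⟨n, hn⟩ := (h.eventually_lt_gromovProductPoint hd hne hX o C).exists
  exact absurd (lt_dist_of_lt_gromovProductPoint hn)
    (not_lt.2 (Set.Infinite.natEmbedding _ hinf (φ n)).2)

include hd hX in
theorem IsCompatibleMetric.eq_of_lt_gromovProductPoint {o : X} {p : ℕ → X}
    {ξ η : GromovBoundary X}
    (h : ∀ R : ℝ, ∀ᶠ n in atTop, (R : EReal) < gromovProductPoint o ξ (p n))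
    (h' : ∀ R : ℝ, ∀ᶠ n in atTop, (R : EReal) < gromovProductPoint o η (p n)) : ξ = η := by
  have := hd.t2Space
  by_contra hne
  obtain ⟨K, hK⟩ := exists_not_lt_gromovProductBoundary o hne
  obtain ⟨n, h1, h2⟩ := ((h (K + 3 * δ + 1)).and (h' (K + 3 * δ + 1))).exists
  have h3 := hX.lt_gromovProductBoundary_of_point h1 h2
    (by rw [gromovProduct_self]; exact lt_dist_of_lt_gromovProductPoint h1)
  rw [show K + 3 * δ + 1 - 3 * δ - 1 = K by ring] at h3
  exact hK h3

include hd hne hX in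
theorem IsCompatibleMetric.exists_biConverges_of_lt {o : X} {g : ℕ → Γ} {ξ : GromovBoundary X}
    (h : ∀ R : ℝ, ∀ᶠ n in atTop, (R : EReal) < gromovProductPoint o ξ ((g n).1 o)) :
    ∃ (b : GromovBoundary X) (φ : ℕ → ℕ), StrictMono φ ∧ BiConverges (g ∘ φ) ξ b := by
  obtain ⟨φ, hφ, ⟨γ, hγ⟩ | hinj⟩ := exists_strictMono_const_or_injective g
  · obtain ⟨n, hn⟩ := (hφ.tendsto_atTop.eventually (h (dist o (γ.1 o)))).exists
    rw [hγ] at hn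
    exact absurd (lt_dist_of_lt_gromovProductPoint hn) (lt_irrefl _)
  · obtain ⟨a, b, ψ, hψ, hab⟩ := hd.exists_biConverges hinj
    have e : a = ξ := hd.eq_of_lt_gromovProductPoint hX
      (hab.eventually_lt_gromovProductPoint hd hne hX o)
      fun R => (hφ.comp hψ).tendsto_atTop.eventually (h R)
    subst e
    exact ⟨b, φ ∘ ψ, hφ.comp hψ, hab⟩

include hd hne hX in
/-- The orbit of the base point follows a ray to any boundary point `ξ`; the inverses converge
to a point other than `ξ` if `Γ` fixes `ξ`. -/
theorem IsCompatibleMetric.exists_biConverges_along_ray (hcoc : IsCocompact Γ) (o : X)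
    (c : GeodesicRay X) (hfix : ∀ γ : Γ, γ • c.endpoint = c.endpoint) :
    ∃ (b : GromovBoundary X) (g : ℕ → Γ) (m : ℕ → ℝ≥0) (R : ℝ), b ≠ c.endpoint ∧
      BiConverges g c.endpoint b ∧ ∀ n, dist (c.1 (m n)) ((g n).1 o) ≤ R := by
  obtain ⟨R, hR⟩ := hcoc.exists_dist_le o
  choose g hg using fun n : ℕ => hR (c.1 n)
  have hlim : ∀ K : ℝ, ∀ᶠ n in atTop,
      (K : EReal) < gromovProductPoint o c.endpoint ((g n).1 o) := by
    intro K
    have h1 : ∀ᶠ n : ℕ in atTop, K + 1 + dist o (c.1 0) + R < n :=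
      tendsto_natCast_atTop_atTop.eventually_gt_atTop _
    filter_upwards [h1] with n hn
    refine lt_gromovProductPoint (lt_add_one K) ?_
    filter_upwards [eventually_ge_atTop (n : ℝ≥0)] with s hs
    have h2 := c.min_sub_le_gromovProduct o s n
    rw [min_eq_right (NNReal.coe_le_coe.2 hs)] at h2
    have h3 := gromovProduct_le_add_right o (c.1 s) (c.1 n) ((g n).1 o)
    have h4 := hg n
    simp only [NNReal.coe_natCast] at h2
    linarith
  obtain ⟨b, φ, hφ, hb⟩ := hd.exists_biConverges_of_lt hne hX hlim
  refine ⟨b, g ∘ φ, fun n => (φ n : ℝ≥0), R, fun e => ?_, hb, fun n => hg _⟩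
  subst e
  -- If the inverses also tended to the fixed endpoint, then `γ⁻¹ o` would have a large product with
  -- the ray `γ⁻¹ c`, which has the same endpoint. Moved back by `γ`, this is a product of `o` and
  -- `c t` based near an intermediate point of the ray, hence bounded.
  obtain ⟨n, hn⟩ := (hb.inv.eventually_lt_gromovProductPoint hd hne hX o
    (dist o (c.1 0) + R + δ)).exists
  set γ := g (φ n)
  have he : (c.map γ⁻¹.1).endpoint = c.endpoint := hfix γ⁻¹
  rw [← he] at hn
  obtain ⟨t, ht, hnt⟩ := ((hX.eventually_ray hn).and (eventually_ge_atTop (φ n : ℝ≥0))).exists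
  have h1 : gromovProduct o (γ⁻¹.1 (c.1 t)) (γ⁻¹.1 o) =
      gromovProduct (γ.1 o) (c.1 t) o := by
    rw [← gromovProduct_map γ⁻¹.1 (γ.1 o)]
    congr 1
    exact (γ.1.symm_apply_apply o).symm
  have h2 : R + dist o (c.1 0) < gromovProduct o (γ⁻¹.1 (c.1 t)) (γ⁻¹.1 o) := by
    have : dist o (c.1 0) + R + δ - δ < gromovProduct o (γ⁻¹.1 (c.1 t)) (γ⁻¹.1 o) := ht
    linarith
  rw [h1] at h2
  have h3 := gromovProduct_le_add_base (γ.1 o) (c.1 (φ n)) (c.1 t) o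
  have h4 := hg (φ n)
  rw [dist_comm] at h4
  have h5 : gromovProduct (c.1 (φ n)) (c.1 t) o ≤ dist o (c.1 0) := by
    have i1 := c.dist_le o (φ n)
    have i2 := c.le_dist o t
    have i3 := NNReal.coe_le_coe.2 hnt
    simp only [gromovProduct, c.dist_eq]
    rw [abs_of_nonpos (by linarith), dist_comm _ o, dist_comm _ o]
    linarith
  linarith

include hd hne hX in
theorem IsCompatibleMetric.exists_smul_ne (hcoc : IsCocompact Γ) (ξ : GromovBoundary X) :
    ∃ γ : Γ, γ • ξ ≠ ξ := by
  have := hd.t2Space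
  by_contra! hfix
  obtain ⟨c, rfl⟩ := exists_endpoint_eq ξ
  obtain ⟨b, g, m, R, hb, hg, hR⟩ :=
    hd.exists_biConverges_along_ray hne hX hcoc (c.1 0) c hfix
  -- Some `g n` is loxodromic, and the globally fixed endpoint must be one of its two fixed points;
  -- `e` is the other.
  obtain ⟨h, e, he, he', hhe⟩ : ∃ (h : Γ) (e : GromovBoundary X), e ≠ c.endpoint ∧ h • e = e ∧
      ∀ z, h • z = z → z = c.endpoint ∨ z = e := by
    obtain ⟨n, x, y, hl, -⟩ :=
      (hd.eventually_exists_isLoxodromic hg hb.symm one_pos).exists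
    rcases hl.eq_or_eq_of_smul_eq (hfix _) with hx | hy
    · exact ⟨g n, y, hx ▸ hl.ne.symm, hl.repelling_fixed, fun z hz => hx ▸ hl.eq_or_eq_of_smul_eq hz⟩
    · exact ⟨g n, x, hy ▸ hl.ne, hl.attracting_fixed, fun z hz => hy ▸ (hl.eq_or_eq_of_smul_eq hz).symm⟩
  obtain ⟨k, hk⟩ : ∃ k : Γ, k • e ≠ e := by
    obtain ⟨k, h | h⟩ := hne.exists_smul_ne_or he
    exacts [⟨k, h⟩, absurd (hfix k) h]
  have hpre : ∀ (γ : Γ) (z : GromovBoundary X), γ • z = c.endpoint → z = c.endpoint :=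
    fun γ z hz => MulAction.injective γ (hz.trans (hfix γ).symm)
  -- As `u` fixes the endpoint, it moves the points of the ray, hence the nearby `g n o`, a bounded
  -- distance. The conjugates thus move the base point boundedly and take finitely many values.
  have hconj : ∀ (u : Γ) (φ : ℕ → ℕ), StrictMono φ → ∃ ψ : ℕ → ℕ, StrictMono ψ ∧
      ∃ a : Γ, ∀ n, (g (φ (ψ n)))⁻¹ * u * g (φ (ψ n)) = a := by
    intro u φ hφ
    obtain ⟨ψ, hψ, h1 | h1⟩ := exists_strictMono_const_or_injective
      fun n => (g (φ n))⁻¹ * u * g (φ n)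
    · exact ⟨ψ, hψ, h1⟩
    · exfalso
      have hcu : c.endpoint = (c.map u.1).endpoint := (hfix u).symm
      obtain ⟨C, hC⟩ := exists_dist_le hcu
      refine Set.infinite_of_injective_forall_mem h1 (fun n => ?_)
        (hd.finite_setOf_dist_le hne hX (c.1 0) (C + 2 * R))
      have h2 := hC (m (φ (ψ n)))
      have h3 := hR (φ (ψ n))
      have h4 : dist (u.1 (c.1 (m (φ (ψ n))))) (u.1 ((g (φ (ψ n))).1 (c.1 0))) ≤ R := by
        rwa [u.1.dist_eq]
      change dist (c.1 0) (((g (φ (ψ n)))⁻¹).1 (u.1 ((g (φ (ψ n))).1 (c.1 0)))) ≤ C + 2 * R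
      rw [dist_comm, Subgroup.dist_coe_inv_apply]
      have h5 := dist_triangle4 ((g (φ (ψ n))).1 (c.1 0)) (c.1 (m (φ (ψ n))))
        (u.1 (c.1 (m (φ (ψ n))))) (u.1 ((g (φ (ψ n))).1 (c.1 0)))
      rw [dist_comm ((g (φ (ψ n))).1 (c.1 0)) (c.1 _), dist_comm ((g (φ (ψ n))).1 (c.1 0))] at h5
      have h6 : dist (c.1 (m (φ (ψ n)))) (u.1 (c.1 (m (φ (ψ n))))) ≤ C := h2
      linarith
  obtain ⟨φ, hφ, a, ha⟩ := hconj h id strictMono_id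
  obtain ⟨ψ, hψ, a', ha'⟩ := hconj (k * h * k⁻¹) φ hφ
  set G : ℕ → Γ := fun n => g (φ (ψ n)) with hG
  have hGlim : BiConverges G c.endpoint b := hg.comp (hφ.comp hψ).tendsto_atTop
  -- Constant conjugates mean that `G n * (G 0)⁻¹` commutes with `u`. Taking `u` to be `h` and `k *
  -- h * k⁻¹`, it fixes both `e` and `k • e`. But fixed points off the endpoint are all carried to
  -- `b` by `(G 0)⁻¹`, contradicting `k • e ≠ e`.
  have hcomm : ∀ (u w : Γ), (∀ n, (G n)⁻¹ * u * G n = w) → ∀ z : GromovBoundary X, u • z = z →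
      ∀ n, u • (G n * (G 0)⁻¹) • z = (G n * (G 0)⁻¹) • z := by
    intro u w hw z hz n
    have h1 : u = G 0 * w * (G 0)⁻¹ := by rw [← hw 0]; group
    have h2 : u = G n * w * (G n)⁻¹ := by rw [← hw n]; group
    have h3 : u * (G n * (G 0)⁻¹) = (G n * (G 0)⁻¹) * u := by
      nth_rewrite 1 [h2]
      rw [h1]
      group
    rw [← mul_smul, h3, mul_smul, hz]
  have hfixe : ∀ n, (G n * (G 0)⁻¹) • e = e := by
    intro n
    rcases hhe _ (hcomm h a (fun n => ha _) e he' n) with h1 | h1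
    · exact absurd (hpre _ _ h1) he
    · exact h1
  have hfixke : ∀ n, (G n * (G 0)⁻¹) • k • e = k • e := by
    intro n
    have h1 : (k * h * k⁻¹) • k • e = k • e := by
      rw [mul_smul, inv_smul_smul, mul_smul, he']
    have h2 := hcomm _ a' ha' _ h1 n
    rw [mul_smul (k * h), mul_smul k h, ← eq_inv_smul_iff] at h2
    rcases hhe _ h2 with h3 | h3
    · rw [inv_smul_eq_iff, hfix] at h3
      exact absurd (hpre _ _ (hpre _ _ h3)) he
    · rwa [inv_smul_eq_iff] at h3
  have hlim : ∀ z : GromovBoundary X, (∀ n, (G n * (G 0)⁻¹) • z = z) → z ≠ c.endpoint →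
      (G 0)⁻¹ • z = b := by
    intro z hz hzc
    by_contra hzb
    have h1 := hGlim.forward.tendsto_const fun e => hzb (ofPoint_injective e)
    have h2 : ∀ n, G n • (ofPoint ((G 0)⁻¹ • z) : GroupUnion Γ (GromovBoundary X)) = ofPoint z :=
      fun n => by rw [smul_ofPoint, ← mul_smul, hz]
    simp only [h2] at h1
    exact hzc (ofPoint_injective (Γ := Γ) (tendsto_nhds_unique tendsto_const_nhds h1))
  exact hk (MulAction.injective _ ((hlim _ hfixke fun h1 => he (hpre _ _ h1)).trans (hlim e hfixe he).symm))

end Orbit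

/-! ## Magnitudes of expanding coarse-cocycles -/

section Magnitude

open GroupUnion GeodesicRay

theorem IsCoarseCocycle.eventually_abs_sub_lt {Γ M : Type*} [Group Γ] [TopologicalSpace M]
    [MulAction Γ M] {κ : ℝ} {σ : Γ → M → ℝ} (h : IsCoarseCocycle κ σ) (γ : Γ) (x₀ : M) :
    ∀ᶠ x in 𝓝 x₀, |σ γ x₀ - σ γ x| < κ + 1 := by
  have h1 : limsup (fun x : M => ((|σ γ x₀ - σ γ x| : ℝ) : EReal)) (𝓝 x₀) <
      ((κ + 1 : ℝ) : EReal) :=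
    (h.coarselyContinuous γ x₀).trans_lt (EReal.coe_lt_coe_iff.2 (lt_add_one κ))
  filter_upwards [eventually_lt_of_limsup_lt h1 (by isBoundedDefault)] with x hx
  exact_mod_cast hx

theorem lt_gromovProductPoint_of_dist {X : Type*} [MetricSpace X] {o p q : X}
    {ξ : GromovBoundary X} {R : ℝ}
    (h : ((R + dist p q + 1 : ℝ) : EReal) < gromovProductPoint o ξ p) :
    (R : EReal) < gromovProductPoint o ξ q := by
  obtain ⟨c, rfl, hc⟩ := exists_ray_of_lt_gromovProductPoint h
  refine lt_gromovProductPoint (lt_add_one R) ?_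
  filter_upwards [hc] with t ht
  linarith [gromovProduct_le_add_right o (c.1 t) p q]

/-- The numbers `N γ` are magnitudes for `σ`: up to a constant, `σ γ x` agrees with `N γ` for `x`
away from `γ⁻¹`. -/
def IsMagnitude {Γ M : Type*} [Group Γ] [MetricSpace (GroupUnion Γ M)] (σ : Γ → M → ℝ)
    (N : Γ → ℝ) : Prop :=
  ∀ ε > 0, ∃ C > 0, ∀ (γ : Γ) (x : M),
    ε < dist (GroupUnion.ofPoint x : GroupUnion Γ M) (GroupUnion.ofGroup γ⁻¹) →
      N γ - C ≤ σ γ x ∧ σ γ x ≤ N γ + C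

theorem BiConverges.mul_right {Γ M : Type*} [Group Γ] [TopologicalSpace M] [MulAction Γ M]
    [MetricSpace (GroupUnion Γ M)] (hd : IsCompatibleMetric Γ M) {g : ℕ → Γ} {a b : M}
    (h : BiConverges g a b) (f : Γ) : BiConverges (fun n => g n * f) a (f⁻¹ • b) := by
  constructor
  · intro z hz
    have hz' : f • z ≠ ofPoint b := fun e => hz (by rw [← smul_ofPoint, ← e, inv_smul_smul])
    have h1 := (h.forward _ hz').comp (tendsto_fst.prodMk
      (((hd.convergence.continuous_smul f).tendsto z).comp tendsto_snd))
    refine h1.congr fun p => ?_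
    simp only [Function.comp, mul_smul]
  · intro z hz
    have h1 := ((hd.convergence.continuous_smul f⁻¹).tendsto _).comp (h.backward z hz)
    refine h1.congr fun p => ?_
    simp only [Function.comp, mul_inv_rev, mul_smul]

variable {X : Type*} [MetricSpace X] {Γ : Subgroup (X ≃ᵢ X)}
  [MetricSpace (GroupUnion Γ (GromovBoundary X))]
  (hd : IsCompatibleMetric Γ (GromovBoundary X)) (hne : IsNonelementary Γ (GromovBoundary X))
  {δ : ℝ} (hX : FourPoint X δ)

include hd hne hX in
theorem IsCompatibleMetric.exists_tendsto_ofGroup (o : X) (α : ℕ → Γ) :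
    ∃ (φ : ℕ → ℕ) (w : GroupUnion Γ (GromovBoundary X)), StrictMono φ ∧
      Tendsto (fun n => (ofGroup (α (φ n)) : GroupUnion Γ (GromovBoundary X))) atTop (𝓝 w) ∧
      ∀ a, w = ofPoint a → ∀ R : ℝ, ∀ᶠ n in atTop,
        (R : EReal) < gromovProductPoint o a ((α (φ n)).1 o) := by
  obtain ⟨φ, hφ, ⟨γ, hγ⟩ | hinj⟩ := exists_strictMono_const_or_injective α
  · refine ⟨φ, ofGroup γ, hφ, ?_, fun a ha => absurd ha (ofGroup_ne_ofPoint _ _)⟩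
    simp only [hγ, tendsto_const_nhds]
  · obtain ⟨a, b, ψ, hψ, h⟩ := hd.exists_biConverges hinj
    refine ⟨φ ∘ ψ, ofPoint a, hφ.comp hψ, h.tendsto_ofGroup, fun a' ha' => ?_⟩
    obtain rfl := ofPoint_injective ha'
    exact h.eventually_lt_gromovProductPoint hd hne hX o

variable {κ : ℝ} {σ : Γ → GromovBoundary X → ℝ} (hσ : IsCoarseCocycle κ σ) {N : Γ → ℝ}
  (hN : IsMagnitude σ N)

include hd hne hX hσ hN

/-- Magnitudes are coarsely additive. -/
theorem IsMagnitude.exists_abs_sub_le (o : X) (C : ℝ) :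
    ∃ K : ℝ, ∀ α β : Γ, gromovProduct o (α.1 o) (β.1 o) ≤ C →
      |N (α⁻¹ * β) - N α⁻¹ - N β| ≤ K := by
  by_contra! h
  choose α β hC hK using fun n : ℕ => h n
  -- A test point `x` whose three relevant distances stay positive in the limit bounds the defect by
  -- `3 * C + κ`: three uses of the magnitude and one of the cocycle relation.
  have key : ∀ (φ : ℕ → ℕ) (x : GromovBoundary X) (w₁ w₂ w₃ w₄ : GroupUnion Γ (GromovBoundary X)),
      StrictMono φ → w₁ ≠ ofPoint x → w₂ ≠ w₃ → w₄ ≠ ofPoint x →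
      Tendsto (fun n => (ofGroup (β (φ n))⁻¹ : GroupUnion Γ (GromovBoundary X))) atTop (𝓝 w₁) →
      Tendsto (fun n => β (φ n) • (ofPoint x : GroupUnion Γ (GromovBoundary X))) atTop (𝓝 w₂) →
      Tendsto (fun n => (ofGroup (α (φ n)) : GroupUnion Γ (GromovBoundary X))) atTop (𝓝 w₃) →
      Tendsto (fun n => (β (φ n))⁻¹ • (ofGroup (α (φ n)) : GroupUnion Γ (GromovBoundary X)))
        atTop (𝓝 w₄) → False := by
    intro φ x w₁ w₂ w₃ w₄ hφ h1 h23 h4 t1 t2 t3 t4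
    obtain ⟨ε, hε, hε1, hε2, hε3⟩ : ∃ ε > 0, ε < dist (ofPoint x) w₁ ∧ ε < dist w₂ w₃ ∧
        ε < dist (ofPoint x) w₄ := by
      obtain ⟨ε, h, h'⟩ := exists_between (lt_min (dist_pos.2 h1.symm)
        (lt_min (dist_pos.2 h23) (dist_pos.2 h4.symm)))
      exact ⟨ε, h, (lt_min_iff.1 h').1, lt_min_iff.1 (lt_min_iff.1 h').2⟩
    obtain ⟨C, -, hCN⟩ := hN ε hε
    have e4 : ∀ᶠ n : ℕ in atTop, 3 * C + κ < n :=
      tendsto_natCast_atTop_atTop.eventually_gt_atTop _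
    obtain ⟨n, i1, i2, i3, i4⟩ := (((tendsto_const_nhds.dist t1).eventually_const_lt hε1).and
      (((t2.dist t3).eventually_const_lt hε2).and
      (((tendsto_const_nhds.dist t4).eventually_const_lt hε3).and e4))).exists
    have j1 := hCN (β (φ n)) x i1
    have j2 := hCN (α (φ n))⁻¹ (β (φ n) • x) (by rw [inv_inv]; exact i2)
    have j3 := hCN ((α (φ n))⁻¹ * β (φ n)) x (by simpa [smul_ofGroup] using i3)
    have j4 := abs_le.1 (hσ.cocycle (α (φ n))⁻¹ (β (φ n)) x)
    have j5 : (n : ℝ) ≤ φ n := Nat.cast_le.2 (hφ.id_le n)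
    refine absurd (hK (φ n)) (not_lt.2 (le_trans ?_ (i4.le.trans j5)))
    rw [abs_le]
    constructor <;> linarith
  obtain ⟨φ, w, hφ, hw, hwa⟩ := hd.exists_tendsto_ofGroup hne hX o α
  obtain ⟨ψ, hψ, ⟨b, hb⟩ | hinj⟩ := exists_strictMono_const_or_injective (β ∘ φ)
  · obtain ⟨x, hx⟩ : ∃ x : GromovBoundary X,
        b • (ofPoint x : GroupUnion Γ (GromovBoundary X)) ≠ w := by
      by_contra! hall
      obtain ⟨x, y, z, hxy, -⟩ := hne.exists_three
      exact hxy (ofPoint_injective (MulAction.injective b ((hall x).trans (hall y).symm)))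
    simp only [Function.comp] at hb
    have hlim := hw.comp hψ.tendsto_atTop
    refine key (φ ∘ ψ) x (ofGroup b⁻¹) (b • ofPoint x) w (b⁻¹ • w) (hφ.comp hψ)
      (ofGroup_ne_ofPoint _ _) hx (fun e => hx (by rw [← e, smul_inv_smul])) ?_ ?_ hlim ?_
    · simp only [Function.comp, hb, tendsto_const_nhds]
    · simp only [Function.comp, hb, tendsto_const_nhds]
    · simp only [Function.comp, hb]
      exact ((hd.convergence.continuous_smul b⁻¹).tendsto w).comp hlim
  · obtain ⟨b, b', χ, hχ, hb⟩ := hd.exists_biConverges hinj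
    have hlim := hw.comp (hψ.comp hχ).tendsto_atTop
    -- A common boundary limit of `α` and `β` would make their Gromov products exceed `C`.
    have hwb : ofPoint b ≠ w := fun e => by
      have h1 := (hψ.comp hχ).tendsto_atTop.eventually (hwa b e.symm (C + 2 * δ))
      have h2 := hb.eventually_lt_gromovProductPoint hd hne hX o (C + 2 * δ)
      obtain ⟨n, hn1, hn2⟩ := (h1.and h2).exists
      have h3 := hX.lt_gromovProduct_of_point hn1 hn2
      have h4 := hC (φ (ψ (χ n)))
      simp only [Function.comp] at h3
      linarith
    obtain ⟨x, y, -, hx, -⟩ := hne.exists_pair_ne b'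
    have hxb : (ofPoint x : GroupUnion Γ (GromovBoundary X)) ≠ ofPoint b' :=
      fun e => hx (ofPoint_injective e)
    exact key (φ ∘ ψ ∘ χ) x (ofPoint b') (ofPoint b) w (ofPoint b') (hφ.comp (hψ.comp hχ))
      hxb.symm hwb hxb.symm hb.tendsto_ofGroup_inv (hb.forward.tendsto_const hxb) hlim
      (hb.backward.tendsto hlim hwb.symm)

/-- Magnitudes of elements that go to infinity tend to infinity. -/
theorem IsMagnitude.finite_setOf_le (hcoc : IsCocompact Γ) (o : X) (hprop : IsProperCocycle σ)
    (B : ℝ) : {γ : Γ | N γ ≤ B}.Finite := by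
  have key : ∀ (g : ℕ → Γ) (a b : GromovBoundary X) (B : ℝ), Function.Injective g →
      BiConverges g a b → a ≠ b → ∃ n, B < N (g n) := by
    intro g a b B hg hab hne'
    by_contra! hB
    obtain ⟨ε, hε, hεd⟩ : ∃ ε > 0,
        4 * ε = dist (ofPoint a : GroupUnion Γ (GromovBoundary X)) (ofPoint b) :=
      ⟨dist (ofPoint a : GroupUnion Γ (GromovBoundary X)) (ofPoint b) / 4,
        div_pos (dist_pos.2 fun e => hne' (ofPoint_injective e)) (by norm_num), by ring⟩
    obtain ⟨n₀, hn₀⟩ := eventually_atTop.1 (hd.eventually_exists_isLoxodromic hab hne' hε)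
    choose x y hl hx hy using fun n : ℕ => hn₀ (n + n₀) (Nat.le_add_left _ _)
    have hsep : ∀ n,
        ε ≤ dist (ofPoint (y n) : GroupUnion Γ (GromovBoundary X)) (ofPoint (x n)) := by
      intro n
      have h1 := dist_triangle4 (ofPoint a : GroupUnion Γ (GromovBoundary X)) (ofPoint (x n))
        (ofPoint (y n)) (ofPoint b)
      rw [dist_comm (ofPoint a : GroupUnion Γ (GromovBoundary X)) (ofPoint (x n)),
        dist_comm (ofPoint (x n) : GroupUnion Γ (GromovBoundary X)) (ofPoint (y n))] at h1
      linarith [hx n, hy n]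
    have hinf := hprop (fun n => g (n + n₀)) x y (hg.comp (add_left_injective n₀)) hl
      ⟨ε, hε, Eventually.of_forall hsep⟩
    obtain ⟨C, -, hC⟩ := hN ε hε
    have hlim := hab.tendsto_ofGroup_inv.comp (tendsto_add_atTop_nat n₀)
    obtain ⟨n, h1, h2⟩ := ((hinf.eventually_gt_atTop (B + C)).and
      (hlim.eventually (Metric.ball_mem_nhds _ hε))).exists
    have h3 := dist_triangle4 (ofPoint a : GroupUnion Γ (GromovBoundary X)) (ofPoint (x n))
      (ofGroup (g (n + n₀))⁻¹) (ofPoint b)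
    rw [dist_comm (ofPoint a : GroupUnion Γ (GromovBoundary X)) (ofPoint (x n))] at h3
    have h4 := Metric.mem_ball.1 h2
    simp only [Function.comp] at h4
    have h5 := (hC (g (n + n₀)) (x n) (by linarith [hx n])).2
    linarith [hB (n + n₀)]
  by_contra hinf
  obtain ⟨g, hg, hgB⟩ : ∃ g : ℕ → Γ, Function.Injective g ∧ ∀ n, N (g n) ≤ B :=
    ⟨fun n => (Set.Infinite.natEmbedding _ hinf n : {γ : Γ | N γ ≤ B}),
      Subtype.val_injective.comp (Set.Infinite.natEmbedding _ hinf).injective,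
      fun n => (Set.Infinite.natEmbedding _ hinf n).2⟩
  obtain ⟨a, b, φ, hφ, hab⟩ := hd.exists_biConverges hg
  -- Right multiplication by `f` keeps the attracting limit and moves the repelling one to `f⁻¹ •
  -- b`, changing magnitudes only by a bounded amount.
  obtain ⟨f, hf⟩ : ∃ f : Γ, a ≠ f⁻¹ • b := by
    by_cases h : a = b
    · obtain ⟨γ, hγ⟩ := hd.exists_smul_ne hne hX hcoc b
      exact ⟨γ⁻¹, by rw [inv_inv, h]; exact hγ.symm⟩
    · exact ⟨1, by simpa using h⟩
  obtain ⟨K, hK⟩ := hN.exists_abs_sub_le hd hne hX hσ o (dist o (f.1 o))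
  obtain ⟨n, hn⟩ := key _ a _ (B + N f + K)
    ((mul_left_injective f).comp (hg.comp hφ.injective)) (hab.mul_right hd f) hf
  have h1 := (abs_le.1 (hK (g (φ n))⁻¹ f (gromovProduct_le_dist_right _ _ _))).2
  rw [inv_inv] at h1
  have h2 := hgB (φ n)
  simp only [Function.comp] at hn
  linarith

/-- Magnitudes compute `σ` at boundary points. -/
theorem IsMagnitude.exists_abs_mul_sub_le (o : X) :
    ∃ C : ℝ, ∀ (γ : Γ) (ξ : GromovBoundary X), ∃ R : ℝ, ∀ β : Γ,
      (R : EReal) < gromovProductPoint o ξ (β.1 o) → |N (γ * β) - N β - σ γ ξ| ≤ C := by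
  obtain ⟨x, y, -, hxy, -⟩ := hne.exists_three
  obtain ⟨ε, hε, hεd⟩ : ∃ ε > 0,
      3 * ε = dist (ofPoint x : GroupUnion Γ (GromovBoundary X)) (ofPoint y) :=
    ⟨dist (ofPoint x : GroupUnion Γ (GromovBoundary X)) (ofPoint y) / 3,
      div_pos (dist_pos.2 fun e => hxy (ofPoint_injective e)) (by norm_num), by ring⟩
  obtain ⟨C, -, hC⟩ := hN ε hε
  refine ⟨2 * C + κ + (κ + 1), fun γ ξ => ?_⟩
  by_contra! h
  choose β hβ hβC using fun n : ℕ => h n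
  have hlim : ∀ R : ℝ, ∀ᶠ n in atTop, (R : EReal) < gromovProductPoint o ξ ((β n).1 o) := by
    intro R
    have h1 : ∀ᶠ n : ℕ in atTop, R < n := tendsto_natCast_atTop_atTop.eventually_gt_atTop R
    filter_upwards [h1] with n hn
    exact (EReal.coe_lt_coe_iff.2 hn).trans (hβ n)
  obtain ⟨b, φ, hφ, hb⟩ := hd.exists_biConverges_of_lt hne hX hlim
  -- Of two points at distance `3 * ε`, one is more than `ε` away from `b`. Thus `ε`, and with it
  -- `C`, is independent of `γ` and `ξ`.
  obtain ⟨z, hz⟩ : ∃ z : GromovBoundary X,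
      ε < dist (ofPoint z : GroupUnion Γ (GromovBoundary X)) (ofPoint b) := by
    by_contra! hall
    have h1 := dist_triangle_right (ofPoint x : GroupUnion Γ (GromovBoundary X)) (ofPoint y)
      (ofPoint b)
    linarith [hall x, hall y]
  have hzb : (ofPoint z : GroupUnion Γ (GromovBoundary X)) ≠ ofPoint b :=
    dist_pos.1 (hε.trans hz)
  have t1 := hb.tendsto_ofGroup_inv
  have t2 := hb.backward.tendsto_const (ofGroup_ne_ofPoint γ⁻¹ ξ)
  have t3 := hd.tendsto_ofPoint_iff.1 (hb.forward.tendsto_const hzb)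
  obtain ⟨n, i1, i2, i3⟩ := (((tendsto_const_nhds.dist t1).eventually_const_lt hz).and
    (((tendsto_const_nhds.dist t2).eventually_const_lt hz).and
    (t3.eventually (hσ.eventually_abs_sub_lt γ ξ)))).exists
  simp only [Function.comp, smul_ofGroup] at i1 i2 i3
  have j1 := hC (β (φ n)) z i1
  have j2 := hC (γ * β (φ n)) z (by rwa [mul_inv_rev])
  have j3 := abs_le.1 (hσ.cocycle γ (β (φ n)) z)
  have j4 := abs_le.1 i3.le
  refine absurd (hβC (φ n)) (not_lt.2 ?_)
  rw [abs_le]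
  constructor <;> linarith

end Magnitude

/-! ## The potential of an expanding coarse-cocycle -/

section Potential

open GroupUnion GeodesicRay

variable {X : Type*} [MetricSpace X]

/-- `ψ p q` is coarsely `ψ p u + ψ u q` when the Gromov product of `p` and `q` based at `u` is
bounded. -/
def IsProductAdditive (ψ : X → X → ℝ) : Prop :=
  ∀ r : ℝ, ∃ κ : ℝ, ∀ p q u : X, gromovProduct u p q ≤ r → |ψ p q - (ψ p u + ψ u q)| ≤ κ

theorem IsProductAdditive.exists_additive {ψ : X → X → ℝ} (h : IsProductAdditive ψ) (r : ℝ) :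
    ∃ κ > 0, ∀ (p q u : X) (s : Set X), IsGeodesicSegment s p q →
      (∃ v ∈ s, dist u v < r) → |ψ p q - (ψ p u + ψ u q)| ≤ κ := by
  obtain ⟨κ, hκ⟩ := h r
  refine ⟨max κ 1, lt_max_of_lt_right one_pos, fun p q u s hs ⟨v, hv, huv⟩ => ?_⟩
  exact (hκ p q u ((hs.gromovProduct_le_dist u hv).trans huv.le)).trans (le_max_left _ _)

/-- The point `m` on a geodesic from `o` to `p`, at distance equal to the Gromov product of `p` and
`p'`, is where the paths to `p` and `p'` separate. If `a` leaves the path to `p` earlier, geodesics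
from `a` to either point pass near `m`. -/
theorem FourPoint.exists_branch_point {δ : ℝ} (hX : FourPoint X δ) (hgeo : IsGeodesicSpace X)
    (o p p' : X) : ∃ m : X, ∀ a, gromovProduct o a p + 3 * δ < gromovProduct o p p' →
      gromovProduct m p a ≤ 2 * δ ∧ gromovProduct m p' a ≤ 2 * δ := by
  obtain ⟨s, hs⟩ := hgeo o p
  obtain ⟨m, hm, hom⟩ := hs.exists_dist_eq (gromovProduct_nonneg o p p')
    (gromovProduct_le_dist_left o p p')
  refine ⟨m, fun a ha => ?_⟩
  have hδ := hX.nonneg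
  have h1 := hs.dist_add_dist hm
  have h2 : gromovProduct o m p = gromovProduct o p p' := by
    simp only [gromovProduct] at hom ⊢
    linarith
  have h3 : gromovProduct m o p = 0 := by
    have := gromovProduct_add_gromovProduct o m p
    linarith
  have h4 : gromovProduct o m a < gromovProduct o p p' - 2 * δ := by
    have h5 := hX.le o a m p
    rw [h2] at h5
    rcases min_choice (gromovProduct o a m) (gromovProduct o p p') with h6 | h6 <;>
      rw [h6] at h5 <;> linarith [gromovProduct_comm o a m]
  have h5 := gromovProduct_add_gromovProduct o m a
  have h6 := gromovProduct_add_gromovProduct o m p'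
  have h7 := hX.le o m p p'
  rw [h2, min_self] at h7
  have aux : ∀ x, gromovProduct m o x ≤ δ → gromovProduct m x a ≤ 2 * δ := by
    intro x hx
    have h8 := hX.le m o a x
    rcases min_choice (gromovProduct m o a) (gromovProduct m a x) with h9 | h9 <;>
      rw [h9] at h8 <;> linarith [gromovProduct_comm m a x]
  exact ⟨aux p (by linarith), aux p' (by linarith)⟩

/-- Splitting all four terms at the branch point makes the contributions cancel. Hence `ψ p a - ψ p
a'` is coarsely constant for `p` near a boundary point. -/
theorem IsProductAdditive.exists_abs_le {δ : ℝ} (hX : FourPoint X δ) (hgeo : IsGeodesicSpace X)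
    {ψ : X → X → ℝ} (h : IsProductAdditive ψ) :
    ∃ C : ℝ, ∀ o p p' a a' : X, gromovProduct o a p + 3 * δ < gromovProduct o p p' →
      gromovProduct o a' p + 3 * δ < gromovProduct o p p' →
        |ψ p a - ψ p a' - ψ p' a + ψ p' a'| ≤ C ∧ |ψ a p - ψ a' p - ψ a p' + ψ a' p'| ≤ C := by
  obtain ⟨κ, hκ⟩ := h (2 * δ)
  refine ⟨4 * κ, fun o p p' a a' ha ha' => ?_⟩
  obtain ⟨m, hm⟩ := hX.exists_branch_point hgeo o p p'
  obtain ⟨h1, h2⟩ := hm a ha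
  obtain ⟨h3, h4⟩ := hm a' ha'
  have i1 := abs_le.1 (hκ p a m h1)
  have i2 := abs_le.1 (hκ p' a m h2)
  have i3 := abs_le.1 (hκ p a' m h3)
  have i4 := abs_le.1 (hκ p' a' m h4)
  rw [gromovProduct_comm] at h1 h2 h3 h4
  have j1 := abs_le.1 (hκ a p m h1)
  have j2 := abs_le.1 (hκ a p' m h2)
  have j3 := abs_le.1 (hκ a' p m h3)
  have j4 := abs_le.1 (hκ a' p' m h4)
  rw [abs_le, abs_le]
  refine ⟨⟨?_, ?_⟩, ?_, ?_⟩ <;> linarith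

/-- The potential with `ψ (α o) (β o) ≈ N (α⁻¹ β)`; points of `X` are replaced by orbit points at
distance at most `R`. -/
noncomputable def magnitudePotential (Γ : Subgroup (X ≃ᵢ X)) (o : X) (R : ℝ) (N : Γ → ℝ) (p q : X) : ℝ :=
  sSup {t | ∃ α β : Γ, dist p (α.1 o) ≤ R ∧ dist q (β.1 o) ≤ R ∧ t = N (α⁻¹ * β)}

/-- The supremum runs over all nearby orbit points instead of chosen ones, so the set of values is
invariant and invariance is exact, not merely coarse. -/
theorem isInvariantPotential_magnitudePotential (Γ : Subgroup (X ≃ᵢ X)) (o : X) (R : ℝ)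
    (N : Γ → ℝ) : IsInvariantPotential Γ (magnitudePotential Γ o R N) := by
  have hsub : ∀ (γ : Γ) (p q : X),
      {t | ∃ α β : Γ, dist p (α.1 o) ≤ R ∧ dist q (β.1 o) ≤ R ∧ t = N (α⁻¹ * β)} ⊆
        {t | ∃ α β : Γ, dist (γ.1 p) (α.1 o) ≤ R ∧ dist (γ.1 q) (β.1 o) ≤ R ∧
          t = N (α⁻¹ * β)} := by
    rintro γ p q t ⟨α, β, hα, hβ, rfl⟩
    refine ⟨γ * α, γ * β, ?_, ?_, by group⟩
    · exact (γ.1.dist_eq _ _).trans_le hα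
    · exact (γ.1.dist_eq _ _).trans_le hβ
  intro γ hγ p q
  refine congrArg sSup (Subset.antisymm ?_ (hsub ⟨γ, hγ⟩ p q))
  have h1 := hsub (⟨γ, hγ⟩⁻¹ : Γ) (γ p) (γ q)
  have h2 : ∀ x, (⟨γ, hγ⟩⁻¹ : Γ).1 (γ x) = x := fun x => γ.symm_apply_apply x
  rwa [h2, h2] at h1

variable {Γ : Subgroup (X ≃ᵢ X)} [MetricSpace (GroupUnion Γ (GromovBoundary X))]
  (hd : IsCompatibleMetric Γ (GromovBoundary X)) (hne : IsNonelementary Γ (GromovBoundary X))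
  {δ : ℝ} (hX : FourPoint X δ)

include hd hne hX in
theorem IsCompatibleMetric.exists_abs_le_of_dist_le (o : X) (f : Γ → ℝ) (C : ℝ) :
    ∃ B : ℝ, ∀ γ : Γ, dist o (γ.1 o) ≤ C → |f γ| ≤ B := by
  obtain ⟨B, hB⟩ := ((hd.finite_setOf_dist_le hne hX o C).image fun γ => |f γ|).bddAbove
  exact ⟨B, fun γ hγ => hB ⟨γ, hγ, rfl⟩⟩

variable {κ : ℝ} {σ : Γ → GromovBoundary X → ℝ} (hσ : IsCoarseCocycle κ σ) {N : Γ → ℝ}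
  (hN : IsMagnitude σ N) {o : X} {R : ℝ}

include hd hne hX hσ hN

theorem IsMagnitude.exists_abs_magnitudePotential_sub_le :
    ∃ K : ℝ, ∀ (p q : X) (α β : Γ), dist p (α.1 o) ≤ R → dist q (β.1 o) ≤ R →
      |magnitudePotential Γ o R N p q - N (α⁻¹ * β)| ≤ K := by
  obtain ⟨K, hK⟩ := hN.exists_abs_sub_le hd hne hX hσ o (2 * R)
  obtain ⟨B, hB⟩ := hd.exists_abs_le_of_dist_le hne hX o N (2 * R)
  -- Two choices of orbit points differ by elements moving `o` at most `2 * R`, a finite set on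
  -- which `N` is bounded. Coarse additivity is used once at each end.
  have key : ∀ (p q : X) (α β α' β' : Γ), dist p (α.1 o) ≤ R → dist q (β.1 o) ≤ R →
      dist p (α'.1 o) ≤ R → dist q (β'.1 o) ≤ R →
        |N (α'⁻¹ * β') - N (α⁻¹ * β)| ≤ 2 * K + 2 * B := by
    intro p q α β α' β' hα hβ hα' hβ'
    have e : ∀ u v : Γ, dist o ((u⁻¹ * v).1 o) = dist (u.1 o) (v.1 o) := fun u v => by
      rw [dist_comm, dist_comm (u.1 o)]
      exact Subgroup.dist_coe_inv_apply u (v.1 o) o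
    have h1 : dist o ((α⁻¹ * α').1 o) ≤ 2 * R := by
      rw [e]
      linarith [dist_triangle_left (α.1 o) (α'.1 o) p]
    have h1' : dist o ((α'⁻¹ * α).1 o) ≤ 2 * R := by
      rw [e]
      linarith [dist_triangle_left (α'.1 o) (α.1 o) p]
    have h2 : dist o ((β⁻¹ * β').1 o) ≤ 2 * R := by
      rw [e]
      linarith [dist_triangle_left (β.1 o) (β'.1 o) q]
    have i1 := hK (α⁻¹ * α') (α⁻¹ * β') ((gromovProduct_le_dist_left _ _ _).trans h1)
    have i2 := hK (β⁻¹ * α) (β⁻¹ * β') ((gromovProduct_le_dist_right _ _ _).trans h2)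
    rw [show (α⁻¹ * α')⁻¹ * (α⁻¹ * β') = α'⁻¹ * β' by group,
      show (α⁻¹ * α')⁻¹ = α'⁻¹ * α by group] at i1
    rw [show (β⁻¹ * α)⁻¹ * (β⁻¹ * β') = α⁻¹ * β' by group,
      show (β⁻¹ * α)⁻¹ = α⁻¹ * β by group] at i2
    have i3 := abs_le.1 (hB _ h1')
    have i4 := abs_le.1 (hB _ h2)
    rw [abs_le] at i1 i2 ⊢
    constructor <;> linarith
  refine ⟨2 * K + 2 * B, fun p q α β hα hβ => ?_⟩
  have hne' : {t | ∃ α β : Γ, dist p (α.1 o) ≤ R ∧ dist q (β.1 o) ≤ R ∧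
      t = N (α⁻¹ * β)}.Nonempty := ⟨_, α, β, hα, hβ, rfl⟩
  have hub : N (α⁻¹ * β) + (2 * K + 2 * B) ∈ upperBounds {t | ∃ α β : Γ,
      dist p (α.1 o) ≤ R ∧ dist q (β.1 o) ≤ R ∧ t = N (α⁻¹ * β)} := by
    rintro t ⟨α', β', hα', hβ', rfl⟩
    linarith [(abs_le.1 (key p q α β α' β' hα hβ hα' hβ')).2]
  have h0 := (abs_nonneg _).trans (key p q α β α β hα hβ hα hβ)
  have h1 : magnitudePotential Γ o R N p q ≤ _ := csSup_le hne' hub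
  have h2 : N (α⁻¹ * β) ≤ magnitudePotential Γ o R N p q :=
    le_csSup ⟨_, hub⟩ ⟨α, β, hα, hβ, rfl⟩
  rw [abs_le]
  constructor <;> linarith

variable (hR : ∀ p : X, ∃ γ : Γ, dist p (γ.1 o) ≤ R)
include hR

theorem IsMagnitude.isProductAdditive : IsProductAdditive (magnitudePotential Γ o R N) := by
  intro r
  obtain ⟨K, hK⟩ := hN.exists_abs_magnitudePotential_sub_le hd hne hX hσ (o := o) (R := R)
  -- Each of `p`, `q`, `u` is moved by at most `R` to an orbit point, raising the Gromov product by
  -- at most `3 * R`.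
  obtain ⟨K', hK'⟩ := hN.exists_abs_sub_le hd hne hX hσ o (r + 3 * R)
  refine ⟨3 * K + K', fun p q u hpq => ?_⟩
  obtain ⟨α, hα⟩ := hR p
  obtain ⟨β, hβ⟩ := hR q
  obtain ⟨η, hη⟩ := hR u
  have h1 := abs_le.1 (hK p q α β hα hβ)
  have h2 := abs_le.1 (hK p u α η hα hη)
  have h3 := abs_le.1 (hK u q η β hη hβ)
  have e1 : gromovProduct o ((η⁻¹ * α).1 o) ((η⁻¹ * β).1 o) =
      gromovProduct (η.1 o) (α.1 o) (β.1 o) := by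
    rw [← gromovProduct_map η⁻¹.1 (η.1 o)]
    congr 1
    exact (η.1.symm_apply_apply o).symm
  have h4 := hK' (η⁻¹ * α) (η⁻¹ * β) (by
    rw [e1]
    have i1 := gromovProduct_le_add_base (η.1 o) u (α.1 o) (β.1 o)
    have i2 := gromovProduct_le_add_left u (α.1 o) p (β.1 o)
    have i3 := gromovProduct_le_add_right u p (β.1 o) q
    rw [dist_comm] at i1 i2 i3
    linarith [dist_comm p (α.1 o), dist_comm q (β.1 o), dist_comm u (η.1 o)])
  rw [show (η⁻¹ * α)⁻¹ * (η⁻¹ * β) = α⁻¹ * β by group,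
    show (η⁻¹ * α)⁻¹ = α⁻¹ * η by group, abs_le] at h4
  rw [abs_le]
  constructor <;> linarith

theorem IsMagnitude.isCoarselyAdditivePotential (hcoc : IsCocompact Γ)
    (hprop : IsProperCocycle σ) :
    IsCoarselyAdditivePotential (magnitudePotential Γ o R N) := by
  obtain ⟨K, hK⟩ := hN.exists_abs_magnitudePotential_sub_le hd hne hX hσ (o := o) (R := R)
  have e : ∀ u v : Γ, dist o ((u⁻¹ * v).1 o) = dist (u.1 o) (v.1 o) := fun u v => by
    rw [dist_comm, dist_comm (u.1 o)]
    exact Subgroup.dist_coe_inv_apply u (v.1 o) o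
  refine ⟨fun B => ?_, fun r _ => ?_, fun r _ =>
    (hN.isProductAdditive hd hne hX hσ hR).exists_additive r⟩
  · have hfin := hN.finite_setOf_le hd hne hX hσ hcoc o hprop (B + K)
    obtain ⟨D, hD⟩ := (hfin.image fun γ => dist o (γ.1 o)).bddAbove
    refine ⟨D + 2 * R + 1, fun p q hpq => ?_⟩
    obtain ⟨α, hα⟩ := hR p
    obtain ⟨β, hβ⟩ := hR q
    have h1 := abs_le.1 (hK p q α β hα hβ)
    by_contra hlt
    have h2 : dist o ((α⁻¹ * β).1 o) ≤ D := hD ⟨α⁻¹ * β, by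
      change N (α⁻¹ * β) ≤ B + K
      linarith [not_le.1 hlt], rfl⟩
    rw [e] at h2
    linarith [dist_triangle4 p (α.1 o) (β.1 o) q, dist_comm q (β.1 o)]
  · obtain ⟨B, hB⟩ := hd.exists_abs_le_of_dist_le hne hX o N (r + 2 * R)
    refine ⟨B + K, fun p q hpq => ?_⟩
    obtain ⟨α, hα⟩ := hR p
    obtain ⟨β, hβ⟩ := hR q
    have h1 := abs_le.1 (hK p q α β hα hβ)
    have h2 := abs_le.1 (hB (α⁻¹ * β) (by
      rw [e]
      linarith [dist_triangle4 (α.1 o) p q (β.1 o), dist_comm p (α.1 o)]))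
    rw [abs_le]
    constructor <;> linarith

theorem IsMagnitude.exists_eventually_nhdsIn :
    ∃ C : ℝ, ∀ (γ : Γ) (ξ : GromovBoundary X), ∀ᶠ p in ξ.nhdsIn,
      |magnitudePotential Γ o R N (γ⁻¹.1 o) p - magnitudePotential Γ o R N o p - σ γ ξ| ≤ C := by
  obtain ⟨K, hK⟩ := hN.exists_abs_magnitudePotential_sub_le hd hne hX hσ (o := o) (R := R)
  obtain ⟨C, hC⟩ := hN.exists_abs_mul_sub_le hd hne hX hσ o
  have hR0 : 0 ≤ R := by
    obtain ⟨γ, hγ⟩ := hR o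
    exact dist_nonneg.trans hγ
  refine ⟨2 * K + C, fun γ ξ => ?_⟩
  obtain ⟨R', hR'⟩ := hC γ ξ
  filter_upwards [ξ.eventually_lt_gromovProductPoint o (R' + R + 1)] with p hp
  obtain ⟨β, hβ⟩ := hR p
  have hpβ : ((R' + dist p (β.1 o) + 1 : ℝ) : EReal) ≤ ((R' + R + 1 : ℝ) : EReal) :=
    EReal.coe_le_coe_iff.2 (by linarith)
  have h1 := abs_le.1 (hR' β (lt_gromovProductPoint_of_dist (hpβ.trans_lt hp)))
  have h2 := abs_le.1 (hK (γ⁻¹.1 o) p γ⁻¹ β (by simpa using hR0) hβ)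
  have h3 := abs_le.1 (hK o p 1 β (by simpa using hR0) hβ)
  rw [inv_inv] at h2
  rw [inv_one, one_mul] at h3
  rw [abs_le]
  constructor <;> linarith

end Potential

/-! ## The Gromov-Patterson-Sullivan system of a potential -/

section System

variable {X : Type*} [MetricSpace X] {Γ : Subgroup (X ≃ᵢ X)} {δ : ℝ} (hX : FourPoint X δ)
  (hgeo : IsGeodesicSpace X) {ψ : X → X → ℝ} (hψ : IsProductAdditive ψ) (o : X)

theorem IsInvariantPotential.apply_left (hinv : IsInvariantPotential Γ ψ) (γ : Γ) (p q : X) :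
    ψ (γ.1 p) q = ψ p (γ⁻¹.1 q) := by
  have h : γ.1 (γ⁻¹.1 q) = q := γ.1.apply_symm_apply q
  rw [← hinv γ.1 γ.2 p (γ⁻¹.1 q), h]

include hX hgeo hψ in
/-- The dual cocycle of a potential, as a coarse limit. -/
theorem IsProductAdditive.exists_dual_cocycle (Γ : Subgroup (X ≃ᵢ X)) :
    ∃ (C : ℝ) (σ' : Γ → GromovBoundary X → ℝ), ∀ γ ξ, ∀ᶠ p in ξ.nhdsIn,
      |ψ p (γ⁻¹.1 o) - ψ p o - σ' γ ξ| ≤ C := by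
  obtain ⟨C, hC⟩ := hψ.exists_abs_le hX hgeo
  have h : ∀ (γ : Γ) (ξ : GromovBoundary X), ∃ v : ℝ, ∀ᶠ p in ξ.nhdsIn,
      |ψ p (γ⁻¹.1 o) - ψ p o - v| ≤ C := by
    intro γ ξ
    -- Of the `5 * δ`, `2 * δ` is lost in passing to the product of `p₀` and `p`, and `3 * δ` is the
    -- margin required by `exists_abs_le`.
    have hev := ξ.eventually_lt_gromovProductPoint o (dist o (γ⁻¹.1 o) + 5 * δ)
    obtain ⟨p₀, hp₀⟩ := hev.exists
    refine ⟨ψ p₀ (γ⁻¹.1 o) - ψ p₀ o, ?_⟩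
    filter_upwards [hev] with p hp
    have h1 := hX.lt_gromovProduct_of_point hp₀ hp
    have h2 := (hC o p₀ p (γ⁻¹.1 o) o
      (by linarith [gromovProduct_le_dist_left o (γ⁻¹.1 o) p₀])
      (by linarith [gromovProduct_le_dist_left o o p₀, dist_self o,
        dist_nonneg (x := o) (y := γ⁻¹.1 o)])).1
    rw [abs_le] at h2 ⊢
    constructor <;> linarith
  choose σ' hσ' using h
  exact ⟨C, σ', hσ'⟩

include hX hgeo hψ in
/-- The Gromov product of a potential, as a coarse limit. -/
theorem IsProductAdditive.exists_boundary_product [T1Space (GromovBoundary X)] :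
    ∃ (C : ℝ) (G : GromovBoundary X → GromovBoundary X → ℝ), ∀ x y, x ≠ y →
      ∀ᶠ z in x.nhdsIn ×ˢ y.nhdsIn, |ψ z.1 o + ψ o z.2 - ψ z.1 z.2 - G x y| ≤ C := by
  obtain ⟨C, hC⟩ := hψ.exists_abs_le hX hgeo
  have h : ∀ x y : GromovBoundary X, ∃ v : ℝ, x ≠ y → ∀ᶠ z in x.nhdsIn ×ˢ y.nhdsIn,
      |ψ z.1 o + ψ o z.2 - ψ z.1 z.2 - v| ≤ 2 * C := by
    intro x y
    by_cases hxy : x = y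
    · exact ⟨0, fun h => absurd hxy h⟩
    obtain ⟨K, hK⟩ := exists_not_lt_gromovProductBoundary o hxy
    set K₁ := K + 3 * δ + 1 with hK₁
    have hδ := hX.nonneg
    have hle : ∀ p q, ((|K₁| + 5 * δ + 1 : ℝ) : EReal) < gromovProductPoint o x p →
        ((|K₁| + 5 * δ + 1 : ℝ) : EReal) < gromovProductPoint o y q →
          gromovProduct o p q ≤ |K₁| := by
      intro p q hp hq
      by_contra hlt
      have hc : (K₁ : EReal) ≤ ((|K₁| + 5 * δ + 1 : ℝ) : EReal) :=
        EReal.coe_le_coe_iff.2 (by linarith [le_abs_self K₁])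
      have h1 := hX.lt_gromovProductBoundary_of_point (hc.trans_lt hp) (hc.trans_lt hq)
        ((le_abs_self K₁).trans_lt (not_le.1 hlt))
      rw [show K₁ - 3 * δ - 1 = K by rw [hK₁]; ring] at h1
      exact hK h1
    have hevx := x.eventually_lt_gromovProductPoint o (|K₁| + 5 * δ + 1)
    have hevy := y.eventually_lt_gromovProductPoint o (|K₁| + 5 * δ + 1)
    obtain ⟨p₀, hp₀⟩ := hevx.exists
    obtain ⟨q₀, hq₀⟩ := hevy.exists
    refine ⟨ψ p₀ o + ψ o q₀ - ψ p₀ q₀, fun _ => ?_⟩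
    filter_upwards [hevx.prod_mk hevy] with ⟨p, q⟩ ⟨hp, hq⟩
    have h0 : ∀ r, gromovProduct o o r ≤ |K₁| := fun r =>
      (gromovProduct_le_dist_left o o r).trans (by simp)
    have hpp := hX.lt_gromovProduct_of_point hp₀ hp
    have hqq := hX.lt_gromovProduct_of_point hq₀ hq
    -- The base pair is changed one coordinate at a time, first `p₀` to `p`, then `q₀` to `q`,
    -- whence the bound `2 * C`.
    have h1 := (hC o p₀ p o q₀ (by linarith [h0 p₀])
      (by linarith [hle p₀ q₀ hp₀ hq₀, gromovProduct_comm o p₀ q₀])).1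
    have h2 := (hC o q₀ q o p (by linarith [h0 q₀]) (by linarith [hle p q₀ hp hq₀])).2
    rw [abs_le] at h1 h2 ⊢
    dsimp only
    constructor <;> linarith
  choose G hG using h
  exact ⟨2 * C, G, hG⟩

theorem IsCoarseCocycle.mono {Γ M : Type*} [Group Γ] [TopologicalSpace M] [MulAction Γ M]
    {κ κ' : ℝ} {σ : Γ → M → ℝ} (h : IsCoarseCocycle κ σ) (hκ : κ ≤ κ') : IsCoarseCocycle κ' σ :=
  ⟨fun γ x => (h.coarselyContinuous γ x).trans (EReal.coe_le_coe_iff.2 hκ),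
    fun γ₁ γ₂ x => (h.cocycle γ₁ γ₂ x).trans hκ⟩

include hX in
theorem IsInvariantPotential.isCoarseCocycle_dual (hinv : IsInvariantPotential Γ ψ) {C : ℝ}
    {σ' : Γ → GromovBoundary X → ℝ} (hσ' : ∀ γ ξ, ∀ᶠ p in ξ.nhdsIn,
      |ψ p (γ⁻¹.1 o) - ψ p o - σ' γ ξ| ≤ C) : IsCoarseCocycle (3 * C) σ' where
  coarselyContinuous γ x₀ := by
    refine limsup_le_of_le (by isBoundedDefault) ?_
    filter_upwards [hX.eventually_eventually_nhdsIn (hσ' γ x₀)] with x hx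
    obtain ⟨p, h1, h2⟩ := (hx.and (hσ' γ x)).exists
    have h0 := (abs_nonneg _).trans h1
    rw [EReal.coe_le_coe_iff]
    rw [abs_le] at h1 h2 ⊢
    constructor <;> linarith
  cocycle γ₁ γ₂ x := by
    have h := (GromovBoundary.tendsto_smul_nhdsIn γ₂.1 x).eventually (hσ' γ₁ (γ₂ • x))
    obtain ⟨p, h1, h2, h3⟩ := ((hσ' (γ₁ * γ₂) x).and ((hσ' γ₂ x).and h)).exists
    rw [hinv.apply_left, hinv.apply_left] at h3
    have e : (γ₁ * γ₂)⁻¹.1 o = γ₂⁻¹.1 (γ₁⁻¹.1 o) := by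
      rw [mul_inv_rev]
      rfl
    rw [e] at h1
    rw [abs_le] at h1 h2 h3 ⊢
    constructor <;> linarith

/-- A potential realizing `σ` yields a coarse Gromov-Patterson-Sullivan system. -/
theorem IsInvariantPotential.exists_isCoarseGPSSystem
    [MetricSpace (GroupUnion Γ (GromovBoundary X))] (hX : FourPoint X δ)
    (hgeo : IsGeodesicSpace X) (hd : IsCompatibleMetric Γ (GromovBoundary X))
    (hψ : IsProductAdditive ψ) (hinv : IsInvariantPotential Γ ψ) {κ C : ℝ}
    {σ : Γ → GromovBoundary X → ℝ} (hσ : IsCoarseCocycle κ σ) (hprop : IsProperCocycle σ)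
    (hσψ : ∀ γ ξ, ∀ᶠ p in ξ.nhdsIn, |ψ (γ⁻¹.1 o) p - ψ o p - σ γ ξ| ≤ C) :
    ∃ (κ : ℝ) (σ' : Γ → GromovBoundary X → ℝ)
      (G : {z : GromovBoundary X × GromovBoundary X // z.1 ≠ z.2} → ℝ),
      IsCoarseGPSSystem κ σ σ' G := by
  have := hd.t2Space
  obtain ⟨C', σ', hσ'⟩ := hψ.exists_dual_cocycle hX hgeo o Γ
  obtain ⟨B, G, hG⟩ := hψ.exists_boundary_product hX hgeo o
  have hgromov : ∀ (γ : Γ) (x y : GromovBoundary X), x ≠ y →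
      |(σ' γ x + σ γ y) - (G (γ • x) (γ • y) - G x y)| ≤ C + C' + 2 * B := by
    intro γ x y hxy
    have hγ : γ • x ≠ γ • y := fun e => hxy (MulAction.injective γ e)
    have h := ((GromovBoundary.tendsto_smul_nhdsIn γ.1 x).prodMap
      (GromovBoundary.tendsto_smul_nhdsIn γ.1 y)).eventually (hG _ _ hγ)
    obtain ⟨⟨p, q⟩, ⟨h1, h2⟩, h3, h4⟩ :=
      (((hσ' γ x).prod_mk (hσψ γ y)).and ((hG x y hxy).and h)).exists
    simp only [Prod.map] at h1 h2 h3 h4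
    rw [hinv γ.1 γ.2, hinv.apply_left] at h4
    have e : ψ o (γ.1 q) = ψ (γ⁻¹.1 o) q := by rw [hinv.apply_left, inv_inv]
    rw [e] at h4
    replace h4 : |ψ p (γ⁻¹.1 o) + ψ (γ⁻¹.1 o) q - ψ p q - G (γ • x) (γ • y)| ≤ B := h4
    rw [abs_le] at h1 h2 h3 h4 ⊢
    constructor <;> linarith
  refine ⟨max (max κ (3 * C')) (C + C' + 2 * B), σ', fun z => G z.1.1 z.1.2,
    hσ.mono ((le_max_left _ _).trans (le_max_left _ _)),
    (hinv.isCoarseCocycle_dual hX o hσ').mono ((le_max_right _ _).trans (le_max_left _ _)),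
    hprop, ?_, ?_, fun γ x y hxy => (hgromov γ x y hxy).trans (le_max_right _ _)⟩
  -- At the fixed points the `G` terms cancel, so `σ'` at `a n` is close to `-σ (g n) (b n)`, which
  -- is close to `σ (g n)⁻¹ (b n)`. Properness of `σ` applies to the inverses; the `2 * κ` pays for
  -- the cocycle relation and for `σ 1 (b n)`.
  · intro g a b hg hl ⟨ε, hε, hsep⟩
    have h := hprop (fun n => (g n)⁻¹) b a (inv_injective.comp hg) (fun n => (hl n).inv)
      ⟨ε, hε, by simpa only [dist_comm] using hsep⟩
    refine tendsto_atTop_mono (fun n => ?_)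
      (tendsto_atTop_add_const_right _ (-(C + C' + 2 * B + 2 * κ)) h)
    have h1 := hgromov (g n) (a n) (b n) (hl n).ne
    have h2 := hσ.cocycle (g n)⁻¹ (g n) (b n)
    have h3 := hσ.cocycle 1 1 (b n)
    rw [(hl n).attracting_fixed, (hl n).repelling_fixed] at h1
    rw [(hl n).repelling_fixed, inv_mul_cancel] at h2
    rw [one_smul, mul_one] at h3
    rw [abs_le] at h1 h2 h3
    linarith
  · rintro ⟨⟨x, y⟩, hxy⟩
    -- For pairs `w` near `(x, y)`, a single pair of points of `X` approximates both, so `G` at `w`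
    -- and `G x y` are within `B` of one number.
    refine ⟨_, ?_, |G x y| + 2 * B, fun w hw => hw⟩
    obtain ⟨P, hP, Q, hQ, hPQ⟩ := eventually_prod_iff.1 (hG x y hxy)
    have t1 : Tendsto (fun w : {z : GromovBoundary X × GromovBoundary X // z.1 ≠ z.2} => w.1.1)
        (𝓝 ⟨(x, y), hxy⟩) (𝓝 x) := (continuous_fst.comp continuous_subtype_val).tendsto _
    have t2 : Tendsto (fun w : {z : GromovBoundary X × GromovBoundary X // z.1 ≠ z.2} => w.1.2)
        (𝓝 ⟨(x, y), hxy⟩) (𝓝 y) := (continuous_snd.comp continuous_subtype_val).tendsto _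
    filter_upwards [t1.eventually (hX.eventually_eventually_nhdsIn hP),
      t2.eventually (hX.eventually_eventually_nhdsIn hQ)] with w h1 h2
    obtain ⟨⟨p, q⟩, ⟨h3, h4⟩, h5⟩ := ((h1.prod_mk h2).and (hG _ _ w.2)).exists
    have h6 := hPQ h3 h4
    have h7 := le_abs_self (G x y)
    have h8 := neg_abs_le (G x y)
    rw [abs_le] at h5 h6
    change |G w.1.1 w.1.2| ≤ _
    rw [abs_le]
    constructor <;> linarith

end System

theorem theorem1p9 {X : Type*} [MetricSpace X] [ProperSpace X]
    (hgeo : IsGeodesicSpace X) (hhyp : IsGromovHyperbolic X)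
    (o : X) (Γ : Subgroup (X ≃ᵢ X)) (hdisc : IsDiscreteGroup Γ) (hcoc : IsCocompact Γ)
    (hne : IsNonelementary Γ (GromovBoundary X))
    [MetricSpace (GroupUnion Γ (GromovBoundary X))]
    (hd : IsCompatibleMetric Γ (GromovBoundary X))
    (σ : Γ → GromovBoundary X → ℝ) (hσ : IsExpandingCoarseCocycle σ) :
    (∃ ψ : X → X → ℝ, IsCoarselyAdditivePotential ψ ∧ IsInvariantPotential Γ ψ ∧
      ∃ C : ℝ, ∀ (γ : Γ) (ξ : GromovBoundary X),
        ((σ γ ξ - C : ℝ) : EReal) ≤ potentialCocycle o ψ γ ξ ∧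
        potentialCocycle o ψ γ ξ ≤ ((σ γ ξ + C : ℝ) : EReal)) ∧
    (∃ (κ : ℝ) (σ' : Γ → GromovBoundary X → ℝ)
      (G : {z : GromovBoundary X × GromovBoundary X // z.1 ≠ z.2} → ℝ),
      IsCoarseGPSSystem κ σ σ' G) := by
  obtain ⟨δ, hX⟩ := exists_fourPoint hgeo hhyp
  obtain ⟨⟨κ, hκ⟩, hprop, N, hN⟩ := hσ
  replace hN : IsMagnitude σ N := hN
  obtain ⟨R, hR⟩ := hcoc.exists_dist_le o
  have hinv := isInvariantPotential_magnitudePotential Γ o R N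
  obtain ⟨C, hC⟩ := hN.exists_eventually_nhdsIn hd hne hX hκ hR
  replace hC : ∀ (γ : Γ) (ξ : GromovBoundary X), ∀ᶠ p in ξ.nhdsIn,
      |magnitudePotential Γ o R N ((γ : X ≃ᵢ X).symm o) p - magnitudePotential Γ o R N o p -
        σ γ ξ| ≤ C := hC
  refine ⟨⟨magnitudePotential Γ o R N,
    hN.isCoarselyAdditivePotential hd hne hX hκ hR hcoc hprop, hinv, C, fun γ ξ => ⟨?_, ?_⟩⟩,
    hinv.exists_isCoarseGPSSystem o hX hgeo hd (hN.isProductAdditive hd hne hX hκ hR) hκ hprop hC⟩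
  · refine le_limsup_of_frequently_le (Eventually.frequently ?_) (by isBoundedDefault)
    filter_upwards [hC γ ξ] with p hp
    exact EReal.coe_le_coe_iff.2 (by linarith [(abs_le.1 hp).1])
  · refine limsup_le_of_le (by isBoundedDefault) ?_
    filter_upwards [hC γ ξ] with p hp
    exact EReal.coe_le_coe_iff.2 (by linarith [(abs_le.1 hp).2])
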